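/- Let $\widehat{\mathbb{C}} = \mathbb{C} \cup \{\infty\}$ be the Riemann sphere and let $f \colon \widehat{\mathbb{C}} \to \widehat{\mathbb{C}}$ be a rational map of degree $d \geq 2$. A point $z \in \widehat{\mathbb{C}}$ is periodic for $f$ if $f^{\circ p}(z) = z$ for some integer $p \geq 1$; the least such $p$ is its period, the multiplier $\lambda \in \mathbb{C}$ of $f$ at $z$ is the eigenvalue of the differential of $f^{\circ p}$ at $z$, and the characteristic exponent of $f$ at $z$ is $\chi_f(z) = \frac{1}{p} \log \lvert \lambda \rvert \in [-\infty, +\infty)$. The periodic point $z$ is repelling if $\lvert \lambda \rvert > 1$. Let $\mathcal{C}_f$ be the set of critical points of $f$ and let $\mathcal{P}_f = \bigcup_{n \geq 1} f^{\circ n}(\mathcal{C}_f)$ be the postcritical set of $f$. Suppose that $z_0 \in \widehat{\mathbb{C}}$ is a repelling periodic point for $f$ that does not lie in $\mathcal{P}_f$. Then there is a sequence $(w_n)_{n \geq 0}$ of periodic points for $f$ with pairwise distinct periods such that \[ \lim_{n \to +\infty} \chi_f(w_n) = \chi_f(z_0). \] -/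

import Mathlib

open Filter Topology Function OnePoint

noncomputable section

namespace RiemannSphere

/-- The inversion `z ↦ 1 / z` of the Riemann sphere `ℂ ∪ {∞}`, which exchanges `0` and `∞`. -/
def inversion (z : OnePoint ℂ) : OnePoint ℂ :=
  open Classical in
  z.elim ((0 : ℂ) : OnePoint ℂ) (fun t => if t = 0 then ∞ else ((t⁻¹ : ℂ) : OnePoint ℂ))

/-- The affine coordinate of a point of the sphere other than `∞` (the value `0` at `∞` is never
relevant below). -/
def affineCoord (z : OnePoint ℂ) : ℂ :=
  z.elim 0 id

/-- The standard holomorphic coordinate of the sphere near the point `a`: the coordinate `z` if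
`a` is finite, and the coordinate `1 / z` if `a = ∞`. -/
def chart (a z : OnePoint ℂ) : ℂ :=
  open Classical in
  if a = ∞ then affineCoord (inversion z) else affineCoord z

/-- The inverse of the coordinate `chart a`, as a map from `ℂ` into the sphere. -/
def chartInv (a : OnePoint ℂ) (t : ℂ) : OnePoint ℂ :=
  open Classical in
  if a = ∞ then inversion (t : OnePoint ℂ) else (t : OnePoint ℂ)

/-- The derivative at the point `a` of a self-map of the sphere, holomorphic near `a`, in the
standard coordinates near `a` and near `F a`. If `F a = a`, the same coordinate is used on both
sides, and this is the eigenvalue of the differential of `F` at `a`. -/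
def chartDeriv (F : OnePoint ℂ → OnePoint ℂ) (a : OnePoint ℂ) : ℂ :=
  deriv (fun t : ℂ => chart (F a) (F (chartInv a t))) (chart a a)

/-- The degree of a rational map `P / Q` in lowest terms, `max (deg P) (deg Q)`. -/
def degree (f : RatFunc ℂ) : ℕ :=
  max f.num.natDegree f.denom.natDegree

/-- The self-map of the Riemann sphere given by a rational function `P / Q` in lowest terms.
With `d` its degree, the value at `∞` is the quotient of the coefficients of `X ^ d`. -/
def toMap (f : RatFunc ℂ) (z : OnePoint ℂ) : OnePoint ℂ :=
  open Classical in
  z.elim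
    (if f.denom.coeff (degree f) = 0 then ∞
      else ((f.num.coeff (degree f) / f.denom.coeff (degree f) : ℂ) : OnePoint ℂ))
    (fun t => if f.denom.eval t = 0 then ∞
      else ((f.num.eval t / f.denom.eval t : ℂ) : OnePoint ℂ))

/-- `z` is a periodic point of the rational map `f`. -/
def IsPeriodic (f : RatFunc ℂ) (z : OnePoint ℂ) : Prop :=
  ∃ p : ℕ, 1 ≤ p ∧ (toMap f)^[p] z = z

/-- The period of a periodic point: the least `p ≥ 1` with `f^p z = z`. -/
def period (f : RatFunc ℂ) (z : OnePoint ℂ) : ℕ :=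
  minimalPeriod (toMap f) z

/-- The multiplier of `f` at a periodic point `z` of period `p`: the eigenvalue of the
differential of `f^p` at `z`. -/
def multiplier (f : RatFunc ℂ) (z : OnePoint ℂ) : ℂ :=
  chartDeriv (toMap f)^[period f z] z

/-- A repelling periodic point: the multiplier has modulus greater than `1`. -/
def IsRepellingPeriodic (f : RatFunc ℂ) (z : OnePoint ℂ) : Prop :=
  IsPeriodic f z ∧ 1 < ‖multiplier f z‖

/-- The characteristic exponent `(1 / p) log |λ|` of `f` at a periodic point of period `p` and
multiplier `λ`, equal to `-∞` if `λ = 0`. -/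
def charExponent (f : RatFunc ℂ) (z : OnePoint ℂ) : EReal :=
  open Classical in
  if multiplier f z = 0 then ⊥
  else ((1 / (period f z : ℝ) * Real.log ‖multiplier f z‖ : ℝ) : EReal)

/-- The set of critical points of `f`. -/
def criticalSet (f : RatFunc ℂ) : Set (OnePoint ℂ) :=
  {c | chartDeriv (toMap f) c = 0}

/-- The postcritical set of `f`, the union of the images `f^n (criticalSet f)` for `n ≥ 1`. -/
def postcriticalSet (f : RatFunc ℂ) : Set (OnePoint ℂ) :=
  ⋃ n ≥ 1, (toMap f)^[n] '' criticalSet f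

end RiemannSphere

end

/-! The periodic points come from a homoclinic orbit of `z₀`: a point `b ≠ z₀`, arbitrarily close to
`z₀`, with `f^m b = z₀`. Write `p` for the period of `z₀`, `λ` for its multiplier, and `g` for the
contracting inverse branch of `f^p` fixing `z₀`. As `z₀` is not postcritical, the orbit from `b` to
`z₀` meets no critical point, so `f^m` has an inverse branch `h` near `z₀` with `h z₀ = b`. For
large `n` the map `g^n ∘ h` is a contraction of a small disc, and its fixed point `w` satisfies
`f^(m + p n) w = w`. Its orbit spends time `p n` close to the cycle of `z₀` and a bounded time `m`
elsewhere, so the logarithm of the derivative along it is `n log |λ|` up to `n ε` and a constant;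
division by `m + p n` gives an exponent close to that of `z₀` (`exists_periodic_near`).

The periods are unbounded because `w` is close to `z₀` but different from it, while `z₀` is isolated
among the fixed points of each iterate of `f^p` (`eventually_iterate_ne`).

Homoclinic points exist by a normality argument (`exists_homoclinic`). Otherwise the iterates of
`f^p` on a disc about `z₀` would omit an infinite backward orbit of `z₀`. Landau's theorem would
then bound their derivatives at `z₀`, which are the powers of `λ`. Landau's theorem is itself
deduced from a form of Bloch's theorem by taking two successive inverse cosines. -/

/-! ### The theorems of Bloch and Landau -/

open Complex Metric in
/-- A holomorphic logarithm with a prescribed value at the centre of a disc. -/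
theorem exists_exp_eq {f : ℂ → ℂ} {a : ℂ} {r : ℝ} (hr : 0 < r)
    (hf : DifferentiableOn ℂ f (ball a r)) (h0 : ∀ z ∈ ball a r, f z ≠ 0) {l : ℂ}
    (hl : exp l = f a) :
    ∃ g : ℂ → ℂ, DifferentiableOn ℂ g (ball a r) ∧ g a = l ∧ ∀ z ∈ ball a r, exp (g z) = f z := by
  have hd : DifferentiableOn ℂ (fun z => deriv f z / f z) (ball a r) :=
    (hf.deriv isOpen_ball).div hf h0
  obtain ⟨g, hga, hg⟩ := hd.isExactOn_ball.with_val_at a l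
  have ha : a ∈ ball a r := mem_ball_self hr
  refine ⟨g, fun z hz => (hg z hz).differentiableAt.differentiableWithinAt, hga, fun z hz => ?_⟩
  have hk : ∀ x ∈ ball a r, HasDerivAt (fun x => exp (-g x) * f x) 0 x := by
    intro x hx
    have h1 := (hg x hx).neg.cexp
    have h2 := (hf.differentiableAt (isOpen_ball.mem_nhds hx)).hasDerivAt
    have h3 : HasDerivAt (fun x => exp (-g x) * f x)
      (exp (-g x) * -(deriv f x / f x) * f x + exp (-g x) * deriv f x) x := h1.mul h2
    have h4 : exp (-g x) * -(deriv f x / f x) * f x + exp (-g x) * deriv f x = 0 := by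
      rw [mul_neg, neg_mul, mul_assoc, div_mul_cancel₀ _ (h0 x hx)]
      ring
    rwa [h4] at h3
  have hc := isOpen_ball.is_const_of_deriv_eq_zero (convex_ball a r).isPreconnected
    (fun x hx => (hk x hx).differentiableAt.differentiableWithinAt)
    (fun x hx => (hk x hx).deriv) hz ha
  simp only [hga, ← hl, ← exp_add, neg_add_cancel, exp_zero] at hc
  rw [exp_neg] at hc
  field_simp [exp_ne_zero] at hc
  exact hc.symm

open Complex Metric in
/-- A holomorphic function omitting `1` and `-1` on a disc is the cosine of a holomorphic function,
with a prescribed value at the centre. -/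
theorem exists_cos_eq {f : ℂ → ℂ} {a : ℂ} {r : ℝ} (hr : 0 < r)
    (hf : DifferentiableOn ℂ f (ball a r)) (h1 : ∀ z ∈ ball a r, f z ≠ 1)
    (h2 : ∀ z ∈ ball a r, f z ≠ -1) {c : ℂ} (hc : cos c = f a) :
    ∃ g : ℂ → ℂ, DifferentiableOn ℂ g (ball a r) ∧ g a = c ∧ ∀ z ∈ ball a r, cos (g z) = f z := by
  have ha : a ∈ ball a r := mem_ball_self hr
  have hne : ∀ z ∈ ball a r, 1 - f z ^ 2 ≠ 0 := by
    intro z hz h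
    have : (1 - f z) * (1 + f z) = 0 := by linear_combination h
    rcases mul_eq_zero.1 this with h | h
    · exact h1 z hz (by linear_combination -h)
    · exact h2 z hz (by linear_combination h)
  have hs : sin c ^ 2 = 1 - f a ^ 2 := by
    rw [← hc]; linear_combination sin_sq_add_cos_sq c
  have hs0 : sin c ≠ 0 := by
    intro h; apply hne a ha; rw [← hs, h]; ring
  -- `exp (L / 2)` is a square root of `1 - f ^ 2` with value `sin c` at the centre. Hence `f + I *
  -- exp (L / 2)` equals `exp (I * c)` there, and its logarithm is `I` times the desired function.
  obtain ⟨L, hL, hLa, hLe⟩ := exists_exp_eq (l := 2 * log (sin c)) hr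
    (f := fun z => 1 - f z ^ 2) ((differentiableOn_const (1 : ℂ)).sub (hf.pow 2)) hne
    (by rw [two_mul, exp_add, exp_log hs0, ← sq, hs])
  have hS : ∀ z ∈ ball a r, exp (L z / 2) ^ 2 = 1 - f z ^ 2 := by
    intro z hz
    rw [← exp_nat_mul, ← hLe z hz]; congr 1; push_cast; ring
  have hmul : ∀ z ∈ ball a r,
      (f z + I * exp (L z / 2)) * (f z - I * exp (L z / 2)) = 1 := by
    intro z hz
    linear_combination hS z hz - exp (L z / 2) ^ 2 * I_sq
  obtain ⟨H, hH, hHa, hHe⟩ := exists_exp_eq (f := fun z => f z + I * exp (L z / 2)) (l := I * c) hr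
    (hf.add ((hL.div_const 2).cexp.const_mul I))
    (fun z hz => left_ne_zero_of_mul_eq_one (hmul z hz))
    (by rw [hLa, mul_div_cancel_left₀ _ two_ne_zero, exp_log hs0, mul_comm I c, exp_mul_I, hc,
      mul_comm I])
  refine ⟨fun z => -I * H z, hH.const_mul _, by
    simp only [hHa]; linear_combination -c * I_sq, fun z hz => ?_⟩
  have e1 : exp (-I * H z * I) = f z + I * exp (L z / 2) := by
    rw [← hHe z hz]; congr 1; linear_combination -H z * I_sq
  have e2 : exp (-(-I * H z) * I) = f z - I * exp (L z / 2) := by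
    have : -(-I * H z) * I = -H z := by linear_combination H z * I_sq
    rw [this, exp_neg, hHe z hz]
    exact inv_eq_of_mul_eq_one_right (hmul z hz)
  rw [Complex.cos, e1, e2]
  ring

-- The derivative stays within `3 |f' a|` of `f' a`, so the Schwarz lemma gives `|f' - f' a| ≤ |f'
-- a| / 2` on the disc of radius `r / 6`. There `f` is close enough to its linear part that `|f - f
-- a| ≥ |f' a| r / 12` on the boundary circle, and the quantitative open mapping theorem halves this
-- radius.
open Metric in
theorem ball_subset_image_of_norm_deriv_le {f : ℂ → ℂ} {a : ℂ} {r : ℝ} (hr : 0 < r)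
    (hf : DifferentiableOn ℂ f (ball a r)) (h0 : deriv f a ≠ 0)
    (hb : ∀ z ∈ ball a r, ‖deriv f z‖ ≤ 2 * ‖deriv f a‖) :
    ball (f a) (‖deriv f a‖ * r / 24) ⊆ f '' ball a r := by
  set A := ‖deriv f a‖ with hA
  have hA0 : 0 < A := norm_pos_iff.2 h0
  have hsub : closedBall a (r / 6) ⊆ ball a r := closedBall_subset_ball (by linarith)
  have hd : ∀ z ∈ ball a r, DifferentiableAt ℂ f z := fun z hz =>
    hf.differentiableAt (isOpen_ball.mem_nhds hz)
  have hmaps : Set.MapsTo (deriv f) (ball a r) (closedBall (deriv f a) (3 * A)) := by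
    intro z hz
    rw [mem_closedBall, dist_eq_norm]
    linarith [norm_sub_le (deriv f z) (deriv f a), hb z hz]
  have hlip : ∀ z ∈ closedBall a (r / 6), ‖deriv f z - deriv f a‖ ≤ A / 2 := by
    intro z hz
    have h1 := Complex.dist_le_div_mul_dist_of_mapsTo_ball (hf.deriv isOpen_ball) hmaps (hsub hz)
    rw [dist_eq_norm] at h1
    refine h1.trans ?_
    calc 3 * A / r * dist z a ≤ 3 * A / r * (r / 6) := by
          gcongr; exact hz
      _ = A / 2 := by field_simp; ring
  have hmv : ∀ z ∈ closedBall a (r / 6), ‖f z - f a - deriv f a * (z - a)‖ ≤ A / 2 * ‖z - a‖ := by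
    intro z hz
    have := (convex_closedBall a (r / 6)).norm_image_sub_le_of_norm_hasDerivWithin_le
      (f := fun w => f w - deriv f a * w) (f' := fun w => deriv f w - deriv f a) (C := A / 2)
      (fun w hw => by
        have h2 := ((hasDerivAt_id w).const_mul (deriv f a))
        rw [mul_one] at h2
        exact ((hd w (hsub hw)).hasDerivAt.sub h2).hasDerivWithinAt)
      hlip (mem_closedBall_self (by positivity)) hz
    rwa [show f z - deriv f a * z - (f a - deriv f a * a) = f z - f a - deriv f a * (z - a) by
      ring] at this
  have hsph : ∀ z ∈ sphere a (r / 6), A * r / 12 ≤ ‖f z - f a‖ := by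
    intro z hz
    have h1 := hmv z (sphere_subset_closedBall hz)
    have h2 : ‖z - a‖ = r / 6 := by rwa [mem_sphere, dist_eq_norm] at hz
    have h3 := norm_sub_norm_le (deriv f a * (z - a)) (f z - f a)
    rw [norm_mul, norm_sub_rev (deriv f a * (z - a)), ← hA, h2] at h3
    rw [h2] at h1
    linarith
  have hfreq : ∃ᶠ z in 𝓝 a, f z ≠ f a := by
    have := ((hd a (mem_ball_self hr)).hasDerivAt.eventually_ne (c := f a) h0).frequently
    exact this.filter_mono nhdsWithin_le_nhds
  have hdc : DiffContOnCl ℂ f (ball a (r / 6)) :=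
    (hf.mono hsub).diffContOnCl_ball (by rfl)
  have := hdc.ball_subset_image_closedBall (by positivity) hsph hfreq
  rw [show A * r / 12 / 2 = A * r / 24 by ring] at this
  exact this.trans (Set.image_mono hsub)

open Metric in
/-- A form of Bloch's theorem. -/
theorem exists_ball_subset_image {f : ℂ → ℂ} {a : ℂ} {r : ℝ} (hr : 0 < r)
    (hf : DifferentiableOn ℂ f (ball a r)) :
    ∃ w, ball w (‖deriv f a‖ * r / 96) ⊆ f '' ball a r := by
  by_cases h0 : deriv f a = 0
  · exact ⟨0, by simp [h0]⟩
  have hsub : closedBall a (r / 2) ⊆ ball a r := closedBall_subset_ball (by linarith)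
  have hcont : ContinuousOn (fun z => (r / 2 - dist z a) * ‖deriv f z‖) (closedBall a (r / 2)) :=
    (by fun_prop : Continuous fun z => r / 2 - dist z a).continuousOn.mul
      ((hf.deriv isOpen_ball).continuousOn.mono hsub).norm
  -- At a maximum `c` of the weighted derivative, `|f'| ≤ 2 |f' c|` on the disc of radius `s`, half
  -- the distance left to the circle of radius `r / 2`. Since `s |f' c| ≥ r |f' a| / 4`, the
  -- constant is `4 * 24 = 96`.
  obtain ⟨c, hc, hmax⟩ := (isCompact_closedBall a (r / 2)).exists_isMaxOn
    ⟨a, mem_closedBall_self (by positivity)⟩ hcont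
  have hM : r / 2 * ‖deriv f a‖ ≤ (r / 2 - dist c a) * ‖deriv f c‖ := by
    simpa using hmax (mem_closedBall_self (x := a) (by positivity : 0 ≤ r / 2))
  have hMpos : 0 < r / 2 * ‖deriv f a‖ := by positivity
  have hs : 0 < r / 2 - dist c a := by
    by_contra! h
    have := mul_nonpos_of_nonpos_of_nonneg h (norm_nonneg (deriv f c))
    linarith
  have hfc : deriv f c ≠ 0 := by
    intro h; rw [h, norm_zero, mul_zero] at hM; linarith
  set s := (r / 2 - dist c a) / 2 with hsdef
  have hs' : 0 < s := by positivity
  have hdist : ∀ z ∈ ball c s, dist z a ≤ r / 2 - s := by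
    intro z hz
    have := dist_triangle z c a
    have h2 : dist z c < s := hz
    linarith
  have hin : ball c s ⊆ ball a r := by
    intro z hz
    have := hdist z hz
    rw [mem_ball]; linarith
  have hb : ∀ z ∈ ball c s, ‖deriv f z‖ ≤ 2 * ‖deriv f c‖ := by
    intro z hz
    have h1 := hdist z hz
    have h2 : (r / 2 - dist z a) * ‖deriv f z‖ ≤ (r / 2 - dist c a) * ‖deriv f c‖ :=
      hmax (show z ∈ closedBall a (r / 2) by rw [mem_closedBall]; linarith)
    have h3 : s * ‖deriv f z‖ ≤ s * (2 * ‖deriv f c‖) :=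
      calc s * ‖deriv f z‖ ≤ (r / 2 - dist z a) * ‖deriv f z‖ := by gcongr; linarith
        _ ≤ _ := h2
        _ = s * (2 * ‖deriv f c‖) := by rw [hsdef]; ring
    exact le_of_mul_le_mul_left h3 hs'
  refine ⟨f c, ?_⟩
  refine ((ball_subset_ball ?_).trans
    (ball_subset_image_of_norm_deriv_le hs' (hf.mono hin) hfc hb)).trans (Set.image_mono hin)
  rw [hsdef]; linarith

/-- The points where the cosine takes integer values form a net in the plane. -/
theorem exists_cos_eq_int (w : ℂ) : ∃ u ∈ Metric.ball w 5, ∃ k : ℤ, Complex.cos u = k := by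
  -- At `m π + i y` the cosine is `± cosh y`. Since `cosh` grows by at least `1` over an interval of
  -- length `2` in the positive half-line, it takes an integer value there.
  have key : ∀ t : ℝ, 0 ≤ t → ∃ y : ℝ, |y - t| ≤ 2 ∧ ∃ k : ℤ, Real.cosh y = k := by
    intro t ht
    have h1 : Real.cosh t + 1 ≤ Real.cosh (t + 2) := by
      rw [Real.cosh_add]
      have e1 := Real.one_le_cosh t
      have e2 : (2 : ℝ) ≤ Real.cosh 2 := by
        have := Real.cosh_two_mul 1
        rw [mul_one] at this
        have e3 := Real.self_le_sinh_iff.2 (zero_le_one' ℝ)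
        have e4 := Real.cosh_sq 1
        nlinarith
      have e3 : 0 ≤ Real.sinh t * Real.sinh 2 :=
        mul_nonneg (Real.sinh_nonneg_iff.2 ht) (Real.sinh_nonneg_iff.2 zero_le_two)
      nlinarith
    have h2 : (⌈Real.cosh t⌉ : ℝ) ∈ Set.Icc (Real.cosh t) (Real.cosh (t + 2)) :=
      ⟨Int.le_ceil _, (Int.ceil_lt_add_one _).le.trans h1⟩
    obtain ⟨y, hy, hy'⟩ := intermediate_value_Icc (by linarith : t ≤ t + 2)
      Real.continuous_cosh.continuousOn h2
    exact ⟨y, by rw [abs_le]; constructor <;> linarith [hy.1, hy.2], _, hy'⟩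
  have key' : ∃ y : ℝ, |y - w.im| ≤ 2 ∧ ∃ k : ℤ, Real.cosh y = k := by
    rcases le_total 0 w.im with h | h
    · exact key _ h
    · obtain ⟨y, hy, k, hk⟩ := key (-w.im) (by linarith)
      exact ⟨-y, by rw [← abs_neg]; convert hy using 2; ring, k, by rw [Real.cosh_neg, hk]⟩
  obtain ⟨y, hy, k, hk⟩ := key'
  set m : ℤ := round (w.re / Real.pi) with hm
  have hx : |(m : ℝ) * Real.pi - w.re| ≤ 2 := by
    have h1 := abs_sub_round (w.re / Real.pi)
    have h2 : (m : ℝ) * Real.pi - w.re = -(w.re / Real.pi - m) * Real.pi := by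
      have := Real.pi_ne_zero
      field_simp
      ring
    rw [h2, abs_mul, abs_neg, abs_of_pos Real.pi_pos]
    have := Real.pi_lt_four
    nlinarith [Real.pi_pos]
  refine ⟨(m * Real.pi : ℝ) + y * Complex.I, ?_, ?_⟩
  · rw [Metric.mem_ball, dist_eq_norm]
    refine (Complex.norm_le_abs_re_add_abs_im _).trans_lt ?_
    simp only [Complex.sub_re, Complex.add_re, Complex.ofReal_re, Complex.mul_re, Complex.I_re,
      mul_zero, Complex.ofReal_im, Complex.I_im, sub_zero, add_zero, Complex.sub_im,
      Complex.add_im, Complex.mul_im, mul_one, zero_add]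
    linarith
  · obtain ⟨e, he⟩ : ∃ e : ℤ, Real.cos (m * Real.pi) = e := by
      have h1 := Real.sin_sq_add_cos_sq (m * Real.pi)
      rw [Real.sin_int_mul_pi, zero_pow two_ne_zero, zero_add] at h1
      rcases sq_eq_one_iff.1 h1 with h1 | h1
      · exact ⟨1, by simp [h1]⟩
      · exact ⟨-1, by simp [h1]⟩
    refine ⟨e * k, ?_⟩
    rw [Complex.cos_add_mul_I, ← Complex.ofReal_cos, he, ← Complex.ofReal_sin,
      Real.sin_int_mul_pi, ← Complex.ofReal_cosh, hk]
    push_cast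
    ring

open Complex Metric in
/-- Landau's theorem for functions omitting `0` and `1`. -/
theorem exists_norm_deriv_mul_le (c : ℂ) : ∃ C : ℝ, ∀ (f : ℂ → ℂ) (a : ℂ) (r : ℝ), 0 < r →
    DifferentiableOn ℂ f (ball a r) → (∀ z ∈ ball a r, f z ≠ 0) → (∀ z ∈ ball a r, f z ≠ 1) →
    f a = c → ‖deriv f a‖ * r ≤ C := by
  obtain ⟨γ, hγ⟩ := cos_surjective (2 * c - 1)
  obtain ⟨δ, hδ⟩ := cos_surjective (γ / Real.pi)
  -- With `2 f - 1 = cos G` and `G / π = cos H`, the first factor is `|f' a / H' a|` whenever `H' a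
  -- ≠ 0`. It depends only on `c`, through `γ` and `δ`; and `480 = 5 * 96`.
  refine ⟨‖Real.pi / 2 * sin γ * sin δ‖ * 480, fun f a r hr hf h0 h1 hfa => ?_⟩
  have ha : a ∈ ball a r := mem_ball_self hr
  have hpi : (Real.pi : ℂ) ≠ 0 := by exact_mod_cast Real.pi_ne_zero
  obtain ⟨G, hG, hGa, hGe⟩ := exists_cos_eq (f := fun z => 2 * f z - 1) hr
    ((hf.const_mul 2).sub_const 1)
    (fun z hz h => h1 z hz (by linear_combination h / 2))
    (fun z hz h => h0 z hz (by linear_combination h / 2)) (c := γ) (by rw [hfa, hγ])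
  have hint : ∀ z ∈ ball a r, ∀ k : ℤ, G z / Real.pi ≠ k := by
    intro z hz k h
    have h2 : G z = ((k * Real.pi : ℝ) : ℂ) := by
      rw [div_eq_iff hpi] at h; rw [h]; push_cast; rfl
    have h3 := hGe z hz
    have h4 : sin (G z) = 0 := by
      rw [h2, ← ofReal_sin, Real.sin_int_mul_pi, ofReal_zero]
    have h5 := sin_sq_add_cos_sq (G z)
    rw [h4, h3] at h5
    have h6 : f z * (f z - 1) = 0 := by linear_combination h5 / 4
    rcases mul_eq_zero.1 h6 with h | h
    · exact h0 z hz h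
    · exact h1 z hz (by linear_combination h)
  obtain ⟨H, hH, hHa, hHe⟩ := exists_cos_eq (f := fun z => G z / Real.pi) hr (hG.div_const _)
    (fun z hz => by simpa using hint z hz 1) (fun z hz => by simpa using hint z hz (-1))
    (c := δ) (by rw [hGa, hδ])
  -- `G / π` omits all integers, so `H` omits every point where the cosine is an integer. Its image
  -- therefore contains no disc of radius `5`.
  have hHd : ‖deriv H a‖ * r / 96 ≤ 5 := by
    by_contra! hlt
    obtain ⟨w, hw⟩ := exists_ball_subset_image hr hH
    obtain ⟨u, hu, k, hk⟩ := exists_cos_eq_int w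
    obtain ⟨z, hz, rfl⟩ := hw (ball_subset_ball hlt.le hu)
    rw [hHe z hz] at hk
    exact hint z hz k hk
  have hnhds := isOpen_ball.mem_nhds ha
  have d1 := (hG.differentiableAt hnhds).hasDerivAt
  have d2 := (hH.differentiableAt hnhds).hasDerivAt
  have d3 := (hf.differentiableAt hnhds).hasDerivAt
  have e1 : -sin (G a) * deriv G a = 2 * deriv f a :=
    (d1.ccos.congr_of_eventuallyEq (by
      filter_upwards [hnhds] with z hz using (hGe z hz).symm)).unique
      ((d3.const_mul 2).sub_const 1)
  have e2 : -sin (H a) * deriv H a = deriv G a / Real.pi :=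
    (d2.ccos.congr_of_eventuallyEq (by
      filter_upwards [hnhds] with z hz using (hHe z hz).symm)).unique (d1.div_const _)
  rw [hGa] at e1
  rw [hHa] at e2
  have e3 : deriv f a = Real.pi / 2 * sin γ * sin δ * deriv H a := by
    have : deriv G a = -sin δ * deriv H a * Real.pi := by rw [e2]; field_simp
    rw [this] at e1
    linear_combination -e1 / 2
  rw [e3, norm_mul, mul_assoc]
  gcongr
  linarith

open Metric in
/-- Landau's theorem for functions omitting two given values. -/
theorem exists_norm_deriv_mul_le_of_omit (c : ℂ) {α β : ℂ} (hαβ : α ≠ β) :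
    ∃ C : ℝ, ∀ (f : ℂ → ℂ) (a : ℂ) (r : ℝ), 0 < r →
    DifferentiableOn ℂ f (ball a r) → (∀ z ∈ ball a r, f z ≠ α) → (∀ z ∈ ball a r, f z ≠ β) →
    f a = c → ‖deriv f a‖ * r ≤ C := by
  have hne : β - α ≠ 0 := sub_ne_zero.2 hαβ.symm
  obtain ⟨C, hC⟩ := exists_norm_deriv_mul_le ((c - α) / (β - α))
  refine ⟨C * ‖β - α‖, fun f a r hr hf h0 h1 hfa => ?_⟩
  have := hC (fun z => (f z - α) / (β - α)) a r hr ((hf.sub_const α).div_const _)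
    (fun z hz h => h0 z hz (by rw [div_eq_zero_iff] at h; simpa [hne, sub_eq_zero] using h))
    (fun z hz h => h1 z hz (by rw [div_eq_one_iff_eq hne] at h; linear_combination h))
    (by rw [hfa])
  rw [deriv_div_const, deriv_sub_const, norm_div, div_mul_eq_mul_div,
    div_le_iff₀ (norm_pos_iff.2 hne)] at this
  exact this

/-! ### The two charts of the sphere -/

namespace RiemannSphere

@[simp] theorem inversion_infty : inversion ∞ = ((0 : ℂ) : OnePoint ℂ) := rfl

theorem inversion_coe (t : ℂ) :
    inversion (t : OnePoint ℂ) = if t = 0 then ∞ else ((t⁻¹ : ℂ) : OnePoint ℂ) := by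
  simp [inversion]

@[simp] theorem inversion_zero : inversion ((0 : ℂ) : OnePoint ℂ) = ∞ := by
  simp [inversion_coe]

theorem inversion_coe_of_ne {t : ℂ} (ht : t ≠ 0) :
    inversion (t : OnePoint ℂ) = ((t⁻¹ : ℂ) : OnePoint ℂ) := by
  simp [inversion_coe, ht]

@[simp] theorem inversion_inversion (z : OnePoint ℂ) : inversion (inversion z) = z := by
  induction z using OnePoint.rec with
  | infty => simp
  | coe t =>
    by_cases ht : t = 0
    · simp [ht]
    · rw [inversion_coe_of_ne ht, inversion_coe_of_ne (inv_ne_zero ht), inv_inv]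

@[simp] theorem affineCoord_coe (t : ℂ) : affineCoord (t : OnePoint ℂ) = t := rfl

@[simp] theorem affineCoord_infty : affineCoord ∞ = 0 := rfl

theorem continuousAt_affineCoord {z : OnePoint ℂ} (hz : z ≠ ∞) : ContinuousAt affineCoord z := by
  induction z using OnePoint.rec with
  | infty => exact absurd rfl hz
  | coe t => rw [continuousAt_coe]; exact continuousAt_id

theorem continuous_inversion : Continuous inversion := by
  have key : ContinuousAt inversion ∞ := by
    rw [continuousAt_infty', inversion_infty]
    have h : Tendsto (fun t : ℂ => ((t⁻¹ : ℂ) : OnePoint ℂ)) (coclosedCompact ℂ)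
        (𝓝 ((0 : ℂ) : OnePoint ℂ)) := by
      rw [coclosedCompact_eq_cocompact, ← Metric.cobounded_eq_cocompact]
      exact (continuous_coe.tendsto 0).comp tendsto_inv₀_cobounded
    refine h.congr' ?_
    have h0 : ({0}ᶜ : Set ℂ) ∈ coclosedCompact ℂ := by
      rw [coclosedCompact_eq_cocompact]; exact isCompact_singleton.compl_mem_cocompact
    filter_upwards [h0] with t ht
    exact (inversion_coe_of_ne ht).symm
  have hfin : ∀ t : ℂ, t ≠ 0 → ContinuousAt inversion (t : OnePoint ℂ) := by
    intro t ht
    rw [continuousAt_coe]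
    have h : ContinuousAt (fun t : ℂ => ((t⁻¹ : ℂ) : OnePoint ℂ)) t :=
      continuous_coe.continuousAt.comp (continuousAt_inv₀ ht)
    refine h.congr ?_
    filter_upwards [isOpen_ne.mem_nhds ht] with s hs
    exact (inversion_coe_of_ne hs).symm
  rw [continuous_iff_continuousAt]
  intro z
  induction z using OnePoint.rec with
  | infty => exact key
  | coe t =>
    by_cases ht : t = 0
    · subst ht
      rw [continuousAt_coe]
      change Tendsto _ _ (𝓝 (inversion ((0 : ℂ) : OnePoint ℂ)))
      rw [inversion_zero, ← nhdsNE_sup_pure (0 : ℂ), tendsto_sup]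
      refine ⟨?_, tendsto_pure_left.2 fun s hs => by simpa using mem_of_mem_nhds hs⟩
      have h : Tendsto (fun t : ℂ => ((t⁻¹ : ℂ) : OnePoint ℂ)) (𝓝[≠] (0 : ℂ)) (𝓝 ∞) := by
        have h1 := tendsto_inv₀_nhdsNE_zero (α := ℂ)
        rw [Metric.cobounded_eq_cocompact, ← coclosedCompact_eq_cocompact] at h1
        exact tendsto_coe_infty.comp h1
      refine h.congr' ?_
      filter_upwards [self_mem_nhdsWithin] with s hs
      exact (inversion_coe_of_ne hs).symm
    · exact hfin t ht

open Classical in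
/-- The only point of the sphere not covered by the coordinate `chart u`. -/
noncomputable def antipode (u : OnePoint ℂ) : OnePoint ℂ :=
  if u = ∞ then ((0 : ℂ) : OnePoint ℂ) else ∞

theorem ne_antipode (u : OnePoint ℂ) : u ≠ antipode u := by
  unfold antipode
  split_ifs with h
  · subst h; exact infty_ne_coe 0
  · exact h

@[simp] theorem chart_chartInv (u : OnePoint ℂ) (t : ℂ) : chart u (chartInv u t) = t := by
  unfold chart chartInv
  split_ifs <;> simp

theorem chartInv_chart {u z : OnePoint ℂ} (hz : z ≠ antipode u) :
    chartInv u (chart u z) = z := by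
  unfold chart chartInv
  unfold antipode at hz
  split_ifs at hz ⊢ with h
  · induction z using OnePoint.rec with
    | infty => simp
    | coe t =>
      have ht : t ≠ 0 := by rintro rfl; exact hz rfl
      rw [inversion_coe_of_ne ht, affineCoord_coe, inversion_coe_of_ne (inv_ne_zero ht), inv_inv]
  · induction z using OnePoint.rec with
    | infty => exact absurd rfl hz
    | coe t => simp

@[simp] theorem chartInv_chart_self (u : OnePoint ℂ) : chartInv u (chart u u) = u :=
  chartInv_chart (ne_antipode u)

theorem chartInv_ne_antipode (u : OnePoint ℂ) (t : ℂ) : chartInv u t ≠ antipode u := by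
  unfold chartInv antipode
  split_ifs
  · intro h
    have := congrArg inversion h
    simp at this
  · exact coe_ne_infty t

theorem continuous_chartInv (u : OnePoint ℂ) : Continuous (chartInv u) := by
  by_cases h : u = ∞
  · have : chartInv u = fun t : ℂ => inversion (t : OnePoint ℂ) := by ext; simp [chartInv, h]
    rw [this]
    exact continuous_inversion.comp continuous_coe
  · have : chartInv u = fun t : ℂ => (t : OnePoint ℂ) := by ext; simp [chartInv, h]
    rw [this]
    exact continuous_coe

theorem continuousAt_chart {u z : OnePoint ℂ} (hz : z ≠ antipode u) :
    ContinuousAt (chart u) z := by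
  unfold antipode at hz
  by_cases h : u = ∞
  · have h1 : chart u = affineCoord ∘ inversion := by ext; simp [chart, h]
    rw [h1]
    refine ContinuousAt.comp (continuousAt_affineCoord ?_) continuous_inversion.continuousAt
    intro h2
    have := congrArg inversion h2
    simp [h] at this hz
    exact hz this
  · have h1 : chart u = affineCoord := by ext; simp [chart, h]
    rw [h1]
    exact continuousAt_affineCoord (by simpa [h] using hz)

/-! ### Holomorphic self-maps and the chain rule in charts -/

/-- The expression of a self-map of the sphere in the coordinates `chart u` and `chart v`. -/
noncomputable def coord (u v : OnePoint ℂ) (F : OnePoint ℂ → OnePoint ℂ) (t : ℂ) : ℂ :=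
  chart v (F (chartInv u t))

theorem chartDeriv_eq (F : OnePoint ℂ → OnePoint ℂ) (a : OnePoint ℂ) :
    chartDeriv F a = deriv (coord a (F a) F) (chart a a) := rfl

/-- A self-map of the sphere is holomorphic at `z`. -/
def HolAt (F : OnePoint ℂ → OnePoint ℂ) (z : OnePoint ℂ) : Prop :=
  ContinuousAt F z ∧ ∀ u v, z ≠ antipode u → F z ≠ antipode v →
    AnalyticAt ℂ (coord u v F) (chart u z)

theorem coord_id_self (u : OnePoint ℂ) : coord u u id = id := by
  ext t; simp [coord]

/-- The equality is only local: where `F` hits `antipode v`, the intermediate coordinate is a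
default value. Continuity keeps `F` away from that point near `z`. -/
theorem coord_comp_eventuallyEq {F G : OnePoint ℂ → OnePoint ℂ} {z u v w : OnePoint ℂ}
    (hF : ContinuousAt F z) (hu : z ≠ antipode u) (hv : F z ≠ antipode v) :
    coord u w (G ∘ F) =ᶠ[𝓝 (chart u z)] coord v w G ∘ coord u v F := by
  have h1 : ContinuousAt (F ∘ chartInv u) (chart u z) :=
    ContinuousAt.comp (by rwa [chartInv_chart hu]) (continuous_chartInv u).continuousAt
  have h2 : ∀ᶠ t in 𝓝 (chart u z), F (chartInv u t) ≠ antipode v :=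
    h1.eventually_ne (by simpa [chartInv_chart hu] using hv)
  filter_upwards [h2] with t ht
  simp [coord, chartInv_chart ht]

theorem coord_chart {F : OnePoint ℂ → OnePoint ℂ} {z u : OnePoint ℂ} (v : OnePoint ℂ)
    (hu : z ≠ antipode u) : coord u v F (chart u z) = chart v (F z) := by
  simp [coord, chartInv_chart hu]

/-- This is the holomorphy of the transition maps: each is `t` or `1 / t`, and avoiding both
antipodes excludes `t = 0` in the second case. -/
theorem holAt_id (z : OnePoint ℂ) : HolAt id z := by
  refine ⟨continuousAt_id, fun u v hu hv => ?_⟩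
  simp only [id] at hv
  by_cases h : u = ∞ <;> by_cases h' : v = ∞
  · have : coord u v id = id := by subst h h'; exact coord_id_self _
    rw [this]; exact analyticAt_id
  · have h1 : chart u z ≠ 0 := by
      intro h0
      have := chartInv_chart hu
      rw [h0] at this
      simp [chartInv, h, antipode, h'] at this hv
      exact hv this.symm
    refine AnalyticAt.congr (f := fun t => t⁻¹) (analyticAt_id.inv h1) ?_
    filter_upwards [isOpen_ne.mem_nhds h1] with t ht
    simp [coord, chart, chartInv, h, h', inversion_coe_of_ne ht]
  · have h1 : chart u z ≠ 0 := by
      intro h0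
      have := chartInv_chart hu
      rw [h0] at this
      simp [chartInv, h, antipode, h'] at this hv
      exact hv this.symm
    refine AnalyticAt.congr (f := fun t => t⁻¹) (analyticAt_id.inv h1) ?_
    filter_upwards [isOpen_ne.mem_nhds h1] with t ht
    simp [coord, chart, chartInv, h, h', inversion_coe_of_ne ht]
  · have : coord u v id = id := by ext t; simp [coord, chart, chartInv, h, h']
    rw [this]; exact analyticAt_id

/-- Transition maps are holomorphic, so one pair of charts suffices. -/
theorem holAt_of_coord {F : OnePoint ℂ → OnePoint ℂ} {z u v : OnePoint ℂ} (hF : ContinuousAt F z)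
    (hu : z ≠ antipode u) (hv : F z ≠ antipode v) (h : AnalyticAt ℂ (coord u v F) (chart u z)) :
    HolAt F z := by
  refine ⟨hF, fun u' v' hu' hv' => ?_⟩
  have h1 : AnalyticAt ℂ (coord u v' F) (chart u z) := by
    have := ((holAt_id (F z)).2 v v' hv hv')
    rw [← coord_chart v hu] at this
    exact (this.comp h).congr (coord_comp_eventuallyEq (G := id) hF hu hv).symm
  have h2 : AnalyticAt ℂ (coord u' u id) (chart u' z) := (holAt_id z).2 u' u hu' hu
  have h3 : coord u' u id (chart u' z) = chart u z := coord_chart u hu'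
  rw [← h3] at h1
  exact (h1.comp h2).congr
    (coord_comp_eventuallyEq (F := id) (G := F) continuousAt_id hu' hu).symm

theorem HolAt.comp {F G : OnePoint ℂ → OnePoint ℂ} {z : OnePoint ℂ} (hG : HolAt G (F z))
    (hF : HolAt F z) : HolAt (G ∘ F) z := by
  refine ⟨hG.1.comp hF.1, fun u v hu hv => ?_⟩
  have h1 := hF.2 u (F z) hu (ne_antipode _)
  have h2 := hG.2 (F z) v (ne_antipode _) hv
  rw [← coord_chart (F z) hu] at h2
  exact (h2.comp h1).congr (coord_comp_eventuallyEq hF.1 hu (ne_antipode _)).symm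

theorem HolAt.deriv_coord_comp {F G : OnePoint ℂ → OnePoint ℂ} {z u v w : OnePoint ℂ}
    (hG : HolAt G (F z)) (hF : HolAt F z) (hu : z ≠ antipode u) (hv : F z ≠ antipode v)
    (hw : G (F z) ≠ antipode w) :
    deriv (coord u w (G ∘ F)) (chart u z) =
      deriv (coord v w G) (chart v (F z)) * deriv (coord u v F) (chart u z) := by
  rw [(coord_comp_eventuallyEq hF.1 hu hv).deriv_eq, deriv_comp, coord_chart v hu]
  · rw [coord_chart v hu]
    exact (hG.2 v w hv hw).differentiableAt
  · exact (hF.2 u v hu hv).differentiableAt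

theorem HolAt.chartDeriv_comp {F G : OnePoint ℂ → OnePoint ℂ} {z : OnePoint ℂ}
    (hG : HolAt G (F z)) (hF : HolAt F z) :
    chartDeriv (G ∘ F) z = chartDeriv G (F z) * chartDeriv F z :=
  hG.deriv_coord_comp hF (ne_antipode _) (ne_antipode _) (ne_antipode _)

theorem deriv_coord_id_mul {z u v : OnePoint ℂ} (hu : z ≠ antipode u) (hv : z ≠ antipode v) :
    deriv (coord v u id) (chart v z) * deriv (coord u v id) (chart u z) = 1 := by
  have := (holAt_id z).deriv_coord_comp (F := id) (holAt_id z) hu hv hu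
  rw [id_comp, coord_id_self, deriv_id] at this
  exact this.symm

/-- The derivative at a fixed point may be computed in any coordinate. -/
theorem HolAt.chartDeriv_eq_of_fixed {F : OnePoint ℂ → OnePoint ℂ} {z u : OnePoint ℂ}
    (hF : HolAt F z) (hz : F z = z) (hu : z ≠ antipode u) :
    chartDeriv F z = deriv (coord u u F) (chart u z) := by
  have hz' : F z ≠ antipode z := by rw [hz]; exact ne_antipode z
  have hu' : F z ≠ antipode u := by rw [hz]; exact hu
  have h1 := HolAt.deriv_coord_comp (G := id) (v := z) (w := u) (holAt_id (F z)) hF hu hz' hu'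
  have h2 := HolAt.deriv_coord_comp (G := F) (F := id) (v := z) (w := z) hF (holAt_id z) hu
    (ne_antipode z) hz'
  rw [id_comp, hz] at h1
  rw [comp_id, id] at h2
  have h3 := deriv_coord_id_mul hu (ne_antipode z)
  rw [h1, h2, chartDeriv_eq, hz]
  linear_combination (-deriv (coord z z F) (chart z z)) * h3

/-- Nonvanishing of the derivative may be tested in any coordinates. -/
theorem HolAt.deriv_coord_ne_zero {F : OnePoint ℂ → OnePoint ℂ} {z u v : OnePoint ℂ}
    (hF : HolAt F z) (hu : z ≠ antipode u) (hv : F z ≠ antipode v) (h : chartDeriv F z ≠ 0) :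
    deriv (coord u v F) (chart u z) ≠ 0 := by
  have h1 := HolAt.deriv_coord_comp (G := id) (v := F z) (w := v) (holAt_id (F z)) hF hu
    (ne_antipode _) hv
  have h2 := HolAt.deriv_coord_comp (G := F) (F := id) (v := z) (w := F z) hF (holAt_id z) hu
    (ne_antipode z) (ne_antipode _)
  rw [id_comp] at h1
  rw [comp_id, id] at h2
  rw [h1, h2]
  refine mul_ne_zero ?_ (mul_ne_zero h ?_)
  · exact right_ne_zero_of_mul_eq_one (deriv_coord_id_mul (ne_antipode (F z)) hv)
  · exact right_ne_zero_of_mul_eq_one (deriv_coord_id_mul hu (ne_antipode z))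

theorem HolAt.iterate {F : OnePoint ℂ → OnePoint ℂ} (hF : ∀ z, HolAt F z) (n : ℕ)
    (z : OnePoint ℂ) : HolAt F^[n] z := by
  induction n generalizing z with
  | zero => exact holAt_id z
  | succ n ih => rw [iterate_succ]; exact (ih _).comp (hF z)

/-! ### Rational maps: holomorphy and fibres -/

open Classical in
/-- The point of the sphere with homogeneous coordinates `[x : y]`. -/
noncomputable def frac (x y : ℂ) : OnePoint ℂ :=
  if y = 0 then ∞ else ((x / y : ℂ) : OnePoint ℂ)

theorem frac_mul_left {k : ℂ} (hk : k ≠ 0) (x y : ℂ) : frac (k * x) (k * y) = frac x y := by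
  by_cases hy : y = 0
  · simp [frac, hy]
  · simp [frac, hy, hk, mul_div_mul_left]

/-- The case `y = 0` is included because both sides then take the default value `0`. -/
theorem chart_frac_of_ne {v : OnePoint ℂ} (hv : v ≠ ∞) (x y : ℂ) : chart v (frac x y) = x / y := by
  by_cases hy : y = 0 <;> simp [chart, frac, hv, hy]

theorem chart_infty_frac (x y : ℂ) : chart ∞ (frac x y) = y / x := by
  by_cases hy : y = 0
  · simp [chart, frac, hy]
  · by_cases hx : x = 0
    · simp [chart, frac, hy, hx]
    · simp only [chart, frac, hy, if_true, if_false]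
      rw [inversion_coe_of_ne (div_ne_zero hx hy), affineCoord_coe, inv_div]

theorem frac_eq_infty_iff {x y : ℂ} : frac x y = ∞ ↔ y = 0 := by
  by_cases hy : y = 0 <;> simp [frac, hy]

theorem frac_eq_coe_iff {x y c : ℂ} (h : ¬(x = 0 ∧ y = 0)) :
    frac x y = (c : OnePoint ℂ) ↔ x - c * y = 0 := by
  by_cases hy : y = 0
  · have hx : x ≠ 0 := fun hx => h ⟨hx, hy⟩
    simp [frac, hy, hx]
  · simp only [frac, hy, if_false, OnePoint.coe_eq_coe, div_eq_iff hy, sub_eq_zero]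

open Polynomial

theorem eval_reflect {P : ℂ[X]} {d : ℕ} (hP : P.natDegree ≤ d) {t : ℂ} (ht : t ≠ 0) :
    (reflect d P).eval t = t ^ d * P.eval t⁻¹ := by
  let : Invertible (t⁻¹) := invertibleOfNonzero (inv_ne_zero ht)
  have := eval₂_reflect_mul_pow (RingHom.id ℂ) t⁻¹ d P hP
  rw [invOf_eq_inv, inv_inv, eval₂_id, eval₂_id] at this
  rw [← this, inv_pow]
  field_simp

/-- In any coordinate on the source, a rational map is a quotient of polynomials without common
zeros, at the origin of the opposite coordinate either. -/
theorem exists_toMap_eq_frac (f : RatFunc ℂ) (hd : 1 ≤ degree f) (u : OnePoint ℂ) :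
    ∃ A B : ℂ[X], A.natDegree ≤ degree f ∧ B.natDegree ≤ degree f ∧
      (∀ t, toMap f (chartInv u t) = frac (A.eval t) (B.eval t)) ∧
      toMap f (antipode u) = frac (A.coeff (degree f)) (B.coeff (degree f)) ∧
      (∀ t, ¬(A.eval t = 0 ∧ B.eval t = 0)) ∧
      ¬(A.coeff (degree f) = 0 ∧ B.coeff (degree f) = 0) := by
  have hP : f.num.natDegree ≤ degree f := le_max_left _ _
  have hQ : f.denom.natDegree ≤ degree f := le_max_right _ _
  have hco : ∀ t, ¬(f.num.eval t = 0 ∧ f.denom.eval t = 0) := by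
    rintro t ⟨h1, h2⟩
    obtain ⟨a, b, hab⟩ := f.isCoprime_num_denom
    have := congrArg (Polynomial.eval t) hab
    simp [h1, h2] at this
  have htop : ¬(f.num.coeff (degree f) = 0 ∧ f.denom.coeff (degree f) = 0) := by
    rintro ⟨h1, h2⟩
    rcases max_choice f.num.natDegree f.denom.natDegree with h | h
    · have h' : degree f = f.num.natDegree := h
      rw [h', coeff_natDegree, leadingCoeff_eq_zero] at h1
      rw [h', h1] at hd
      simp at hd
    · have h' : degree f = f.denom.natDegree := h
      rw [h', coeff_natDegree, leadingCoeff_eq_zero] at h2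
      rw [h', h2] at hd
      simp at hd
  have hfin : ∀ t : ℂ, toMap f (t : OnePoint ℂ) = frac (f.num.eval t) (f.denom.eval t) :=
    fun t => rfl
  have hinf : toMap f ∞ = frac (f.num.coeff (degree f)) (f.denom.coeff (degree f)) := rfl
  by_cases hu : u = ∞
  · refine ⟨reflect (degree f) f.num, reflect (degree f) f.denom,
      natDegree_reflect_le.trans (by simp [hP]), natDegree_reflect_le.trans (by simp [hQ]),
      fun t => ?_, ?_, fun t => ?_, ?_⟩
    · by_cases ht : t = 0
      · subst ht
        simp only [chartInv, hu, if_true, inversion_zero, hinf]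
        simp [← coeff_zero_eq_eval_zero, coeff_reflect]
      · simp only [chartInv, hu, if_true, inversion_coe_of_ne ht, hfin]
        rw [eval_reflect hP ht, eval_reflect hQ ht, frac_mul_left (pow_ne_zero _ ht)]
    · simp [antipode, hu, hfin, coeff_reflect, coeff_zero_eq_eval_zero]
    · by_cases ht : t = 0
      · subst ht
        simpa [← coeff_zero_eq_eval_zero, coeff_reflect] using htop
      · rw [eval_reflect hP ht, eval_reflect hQ ht]
        simpa [ht] using hco t⁻¹
    · simpa [coeff_reflect, coeff_zero_eq_eval_zero] using hco 0
  · refine ⟨f.num, f.denom, hP, hQ, fun t => ?_, ?_, hco, htop⟩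
    · simp [chartInv, hu, hfin]
    · simp [antipode, hu, hinf]

theorem holAt_toMap (f : RatFunc ℂ) (hd : 1 ≤ degree f) (z : OnePoint ℂ) :
    HolAt (toMap f) z := by
  obtain ⟨A, B, -, -, hAB, -, hco, -⟩ := exists_toMap_eq_frac f hd z
  set t₀ := chart z z with ht₀
  have hz : chartInv z t₀ = z := chartInv_chart_self z
  have hcoord : coord z (toMap f z) (toMap f) =
      fun t => chart (toMap f z) (frac (A.eval t) (B.eval t)) := by
    ext t; simp [coord, hAB]
  have hfz : toMap f z = frac (A.eval t₀) (B.eval t₀) := by rw [← hAB, hz]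
  obtain ⟨han, hev⟩ : AnalyticAt ℂ (coord z (toMap f z) (toMap f)) t₀ ∧
      ∀ᶠ t in 𝓝 t₀, toMap f (chartInv z t) ≠ antipode (toMap f z) := by
    by_cases hB : B.eval t₀ = 0
    · have hi : toMap f z = ∞ := by rw [hfz, frac_eq_infty_iff.2 hB]
      have hA : A.eval t₀ ≠ 0 := fun h => hco t₀ ⟨h, hB⟩
      have hAe : ∀ᶠ t in 𝓝 t₀, A.eval t ≠ 0 := A.continuous.continuousAt.eventually_ne hA
      constructor
      · rw [hcoord, hi]
        simp only [chart_infty_frac]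
        exact (B.differentiable.analyticAt t₀).div (A.differentiable.analyticAt t₀) hA
      · filter_upwards [hAe] with t ht
        rw [hi, hAB, antipode, if_pos rfl, Ne, frac_eq_coe_iff (hco t)]
        simpa using ht
    · have hi : toMap f z ≠ ∞ := by rwa [hfz, Ne, frac_eq_infty_iff]
      have hBe : ∀ᶠ t in 𝓝 t₀, B.eval t ≠ 0 := B.continuous.continuousAt.eventually_ne hB
      constructor
      · rw [hcoord]
        simp only [chart_frac_of_ne hi]
        exact (A.differentiable.analyticAt t₀).div (B.differentiable.analyticAt t₀) hB
      · filter_upwards [hBe] with t ht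
        rw [hAB, antipode, if_neg hi, Ne, frac_eq_infty_iff]
        exact ht
  -- Continuity on the sphere follows from that of the coordinate expression, because nearby values
  -- remain in the domain of the target chart.
  have hc1 : ContinuousAt (toMap f ∘ chartInv z) t₀ := by
    have h1 : ContinuousAt (fun t => chartInv (toMap f z) (coord z (toMap f z) (toMap f) t)) t₀ :=
      (continuous_chartInv _).continuousAt.comp han.continuousAt
    refine h1.congr ?_
    filter_upwards [hev] with t ht
    exact chartInv_chart ht
  have hc : ContinuousAt (toMap f) z := by
    have h1 : ContinuousAt ((toMap f ∘ chartInv z) ∘ chart z) z :=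
      ContinuousAt.comp hc1 (continuousAt_chart (ne_antipode z))
    refine h1.congr ?_
    have h2 : ∀ᶠ x in 𝓝 z, x ≠ antipode z := isOpen_ne.mem_nhds (ne_antipode z)
    filter_upwards [h2] with x hx
    simp [chartInv_chart hx]
  exact holAt_of_coord hc (ne_antipode z) (ne_antipode _) han

/-- The fibre of a rational map over a point, in the coordinate `chart u` on the source. -/
theorem exists_toMap_eq_iff (f : RatFunc ℂ) (hd : 1 ≤ degree f) (u w : OnePoint ℂ) :
    ∃ (R S : ℂ[X]) (c : ℂ), R.natDegree ≤ degree f ∧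
      (∀ t, toMap f (chartInv u t) = w ↔ R.eval t = 0) ∧
      (toMap f (antipode u) = w ↔ R.coeff (degree f) = 0) ∧
      (∀ t, S.eval t ≠ 0 → coord u w (toMap f) t = c + R.eval t / S.eval t) ∧
      ∀ t, R.eval t = 0 → S.eval t ≠ 0 := by
  obtain ⟨A, B, hA, hB, hAB, hABd, hco, htop⟩ := exists_toMap_eq_frac f hd u
  induction w using OnePoint.rec with
  | infty =>
    refine ⟨B, A, 0, hB, fun t => ?_, ?_, fun t ht => ?_, fun t hB hA => hco t ⟨hA, hB⟩⟩
    · rw [hAB, frac_eq_infty_iff]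
    · rw [hABd, frac_eq_infty_iff]
    · rw [coord, hAB, chart_infty_frac, zero_add]
  | coe c =>
    refine ⟨A - C c * B, B, c, ?_, fun t => ?_, ?_, fun t ht => ?_, fun t hR hB => ?_⟩
    · exact (natDegree_sub_le _ _).trans (max_le hA ((natDegree_C_mul_le _ _).trans hB))
    · rw [hAB, frac_eq_coe_iff (hco t)]; simp
    · rw [hABd, frac_eq_coe_iff htop]; simp
    · rw [coord, hAB, chart_frac_of_ne (coe_ne_infty c)]
      simp only [eval_sub, eval_mul, eval_C]
      field_simp
      ring
    · refine hco t ⟨?_, hB⟩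
      simpa [hB] using hR

/-- Either the fibre polynomial drops degree, and the point outside the chart is a preimage, or it
is nonconstant and has a root. -/
theorem toMap_surjective (f : RatFunc ℂ) (hd : 1 ≤ degree f) : Surjective (toMap f) := by
  intro w
  obtain ⟨R, S, c, hR, hfib, hanti, -, -⟩ := exists_toMap_eq_iff f hd ∞ w
  by_cases h : R.coeff (degree f) = 0
  · exact ⟨_, hanti.2 h⟩
  · have hdeg : degree f ≤ R.natDegree := le_natDegree_of_ne_zero h
    have h0 : R.degree ≠ 0 := by
      intro h0
      have := natDegree_eq_zero_iff_degree_le_zero.2 h0.le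
      omega
    obtain ⟨t, ht⟩ := IsAlgClosed.exists_root R h0
    exact ⟨_, (hfib t).2 ht⟩

/-- A rational map of degree at least two has a second preimage besides any noncritical one. -/
theorem exists_ne_toMap_eq (f : RatFunc ℂ) (hd : 2 ≤ degree f) {y : OnePoint ℂ}
    (hy : chartDeriv (toMap f) y ≠ 0) : ∃ x ≠ y, toMap f x = toMap f y := by
  obtain ⟨R, S, c, hR, hfib, hanti, hcoord, hS⟩ :=
    exists_toMap_eq_iff f (by omega) y (toMap f y)
  -- If `y` were alone in its fibre, the fibre polynomial would have full degree `d ≥ 2` and `t₀` as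
  -- its only root. That root would be multiple, making `y` critical.
  by_contra! hno
  have hlead : R.coeff (degree f) ≠ 0 := fun h => hno _ (ne_antipode y).symm (hanti.2 h)
  have hdeg : R.natDegree = degree f := le_antisymm hR (le_natDegree_of_ne_zero hlead)
  set t₀ := chart y y with ht₀
  have hroot : R.IsRoot t₀ := (hfib t₀).1 (by rw [ht₀, chartInv_chart_self])
  obtain ⟨R₁, hR₁⟩ := dvd_iff_isRoot.2 hroot
  have hR0 : R ≠ 0 := by rintro rfl; simp at hlead
  have hR₁0 : R₁ ≠ 0 := by rintro rfl; simp at hR₁; exact hR0 hR₁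
  have hdeg₁ : 1 + R₁.natDegree = degree f := by
    rw [← hdeg, hR₁, natDegree_mul (X_sub_C_ne_zero _) hR₁0, natDegree_X_sub_C]
  obtain ⟨t₁, ht₁⟩ := IsAlgClosed.exists_root R₁ (by
    intro h0
    have := natDegree_eq_zero_iff_degree_le_zero.2 h0.le
    omega)
  have ht₁' : t₁ = t₀ := by
    by_contra hne
    refine hno (chartInv y t₁) (fun h => hne ?_) ((hfib t₁).2 ?_)
    · rw [ht₀, ← chart_chartInv y t₁, h]
    · rw [hR₁, eval_mul, ht₁.eq_zero, mul_zero]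
  rw [ht₁'] at ht₁
  apply hy
  have hS0 : S.eval t₀ ≠ 0 := hS t₀ hroot
  have hd1 : HasDerivAt (fun t => c + R.eval t / S.eval t) 0 t₀ := by
    have h1 : HasDerivAt (fun t => R.eval t) 0 t₀ := by
      have h2 := R.hasDerivAt t₀
      have h3 : R.derivative.eval t₀ = 0 := by
        rw [hR₁, derivative_mul]
        simp [ht₁.eq_zero]
      rwa [h3] at h2
    have h4 := (h1.div (S.hasDerivAt t₀) hS0).const_add c
    have h5 : R.eval t₀ = 0 := hroot
    simpa [h5] using h4
  rw [chartDeriv_eq, ← ht₀]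
  refine HasDerivAt.deriv (hd1.congr_of_eventuallyEq ?_)
  have hSe : ∀ᶠ t in 𝓝 t₀, S.eval t ≠ 0 := S.continuous.continuousAt.eventually_ne hS0
  filter_upwards [hSe] with t ht
  exact hcoord t ht

/-! ### Existence of homoclinic points -/

/-- The function `1 / (z - c)` on the sphere, with value `0` at `∞`. -/
noncomputable def simplePole (c : ℂ) (z : OnePoint ℂ) : ℂ :=
  z.elim 0 (fun t => (t - c)⁻¹)

/-- Composition with `simplePole c` turns sphere-valued maps omitting `c` into holomorphic
functions, to which Landau's theorem applies. The nonzero factor `k` ensures that growth of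
derivatives is not lost. -/
theorem exists_hasDerivAt_simplePole {c : ℂ} {v : OnePoint ℂ} {s : ℂ} (h : chartInv v s ≠ c) :
    ∃ k ≠ 0, HasDerivAt (fun t => simplePole c (chartInv v t)) k s := by
  by_cases hv : v = ∞
  · have h1 : (fun t => simplePole c (chartInv v t)) = fun t => t / (1 - c * t) := by
      ext t
      by_cases ht : t = 0
      · simp [simplePole, chartInv, hv, ht]
      · simp only [simplePole, chartInv, hv, if_true, inversion_coe_of_ne ht, OnePoint.elim_some]
        rw [show t⁻¹ - c = (1 - c * t) / t by field_simp, inv_div]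
    have h2 : 1 - c * s ≠ 0 := by
      intro h0
      have hs : s ≠ 0 := by rintro rfl; simp at h0
      apply h
      simp only [chartInv, hv, if_true, inversion_coe_of_ne hs, OnePoint.coe_eq_coe]
      field_simp
      linear_combination h0
    refine ⟨(1 * (1 - c * s) - s * (-(c * 1))) / (1 - c * s) ^ 2, ?_, ?_⟩
    · rw [show 1 * (1 - c * s) - s * (-(c * 1)) = 1 by ring]
      exact div_ne_zero one_ne_zero (pow_ne_zero _ h2)
    · rw [h1]
      exact (hasDerivAt_id s).div (((hasDerivAt_id s).const_mul c).const_sub 1) h2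
  · have h1 : (fun t => simplePole c (chartInv v t)) = fun t => (t - c)⁻¹ := by
      ext t
      simp [simplePole, chartInv, hv]
    have h2 : s - c ≠ 0 := by
      intro h0
      apply h
      simp [chartInv, hv, sub_eq_zero.1 h0]
    refine ⟨-1 / (s - c) ^ 2, div_ne_zero (by simp) (pow_ne_zero _ h2), ?_⟩
    rw [h1]
    exact ((hasDerivAt_id s).sub_const c).inv h2

theorem simplePole_injOn {c d : ℂ} (hd : d ≠ c) {z : OnePoint ℂ}
    (h : simplePole c z = (d - c)⁻¹) : z = d := by
  induction z using OnePoint.rec with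
  | infty =>
    have : (d - c)⁻¹ ≠ 0 := inv_ne_zero (sub_ne_zero.2 hd)
    exact absurd h.symm this
  | coe t =>
    have h1 : (t - c)⁻¹ = (d - c)⁻¹ := h
    have h2 := inv_injective h1
    rw [OnePoint.coe_eq_coe]
    linear_combination h2

theorem HolAt.hasDerivAt_simplePole {G : OnePoint ℂ → OnePoint ℂ} {z u v : OnePoint ℂ} {c k : ℂ}
    (hG : HolAt G z) (hu : z ≠ antipode u) (hv : G z ≠ antipode v)
    (hk : HasDerivAt (fun t => simplePole c (chartInv v t)) k (chart v (G z))) :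
    HasDerivAt (fun t => simplePole c (G (chartInv u t)))
      (k * deriv (coord u v G) (chart u z)) (chart u z) := by
  have h1 := (hG.2 u v hu hv).differentiableAt.hasDerivAt
  rw [← coord_chart v hu] at hk
  refine (hk.comp _ h1).congr_of_eventuallyEq ?_
  have h2 : ContinuousAt (G ∘ chartInv u) (chart u z) :=
    ContinuousAt.comp (by rw [chartInv_chart hu]; exact hG.1) (continuous_chartInv u).continuousAt
  have h3 : ∀ᶠ t in 𝓝 (chart u z), G (chartInv u t) ≠ antipode v :=
    h2.eventually_ne (by simpa [chartInv_chart hu] using hv)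
  filter_upwards [h3] with t ht
  simp [coord, chartInv_chart ht]

theorem chartDeriv_iterate_of_fixed {F : OnePoint ℂ → OnePoint ℂ} (hF : ∀ z, HolAt F z)
    {z : OnePoint ℂ} (hz : F z = z) (n : ℕ) : chartDeriv F^[n] z = chartDeriv F z ^ n := by
  induction n with
  | zero =>
    rw [iterate_zero, chartDeriv_eq, id, coord_id_self, deriv_id, pow_zero]
  | succ n ih =>
    rw [iterate_succ, ((HolAt.iterate hF n _).chartDeriv_comp (hF z)), hz, ih, pow_succ]

theorem chartDeriv_iterate_ne_zero {F : OnePoint ℂ → OnePoint ℂ} (hF : ∀ z, HolAt F z)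
    {z : OnePoint ℂ} {m : ℕ} (h : ∀ j < m, chartDeriv F (F^[j] z) ≠ 0) :
    chartDeriv F^[m] z ≠ 0 := by
  induction m with
  | zero => rw [iterate_zero, chartDeriv_eq, id, coord_id_self, deriv_id]; exact one_ne_zero
  | succ m ih =>
    rw [iterate_succ', (hF _).chartDeriv_comp (HolAt.iterate hF m z)]
    exact mul_ne_zero (h m (Nat.lt_succ_self m)) (ih fun j hj => h j (by omega))

/-- A periodic point with a second, nonperiodic preimage has an infinite backward orbit which
avoids its cycle. -/
theorem exists_backward_orbit {α : Type*} {F : α → α} (hF : Surjective F) {z x₀ : α}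
    (hz : z ∈ periodicPts F) (hx₀ : F x₀ = z) (hne : x₀ ≠ F^[minimalPeriod F z - 1] z) :
    ∃ x : ℕ → α, Injective x ∧ (∀ n, F^[n + 1] (x n) = z) ∧ ∀ n k, F^[k] z ≠ x n := by
  choose g hg using hF
  have hg' : ∀ n y, F^[n] (g^[n] y) = y := fun n y =>
    (show LeftInverse F g from hg).iterate n y
  have hp := minimalPeriod_pos_of_mem_periodicPts hz
  -- If `F^k z = x₀`, then the period divides `k + 1`, which forces `x₀` to be the preimage of `z`
  -- in the cycle.
  have h0 : ∀ k, F^[k] z ≠ x₀ := by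
    intro k hk
    have h1 : F^[k + 1] z = z := by rw [iterate_succ_apply', hk, hx₀]
    obtain ⟨j, hj⟩ := IsPeriodicPt.minimalPeriod_dvd h1
    obtain ⟨i, rfl⟩ : ∃ i, j = i + 1 := Nat.exists_eq_succ_of_ne_zero (by rintro rfl; omega)
    have h2 : k = (minimalPeriod F z - 1) + minimalPeriod F z * i := by
      rw [Nat.mul_add_one] at hj; omega
    have h3 : F^[minimalPeriod F z * i] z = z :=
      ((isPeriodicPt_minimalPeriod F z).mul_const i)
    rw [h2, iterate_add_apply, h3] at hk
    exact hne hk.symm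
  have hback : ∀ n, F^[n + 1] (g^[n] x₀) = z := fun n => by
    rw [iterate_succ_apply', hg', hx₀]
  have havoid : ∀ n k, F^[k] z ≠ g^[n] x₀ := by
    intro n k hk
    apply h0 (n + k)
    rw [iterate_add_apply, hk, hg']
  refine ⟨fun n => g^[n] x₀, ?_, hback, havoid⟩
  have hlt : ∀ i j, i < j → g^[i] x₀ ≠ g^[j] x₀ := by
    intro i j hij h
    obtain ⟨l, rfl⟩ := Nat.exists_eq_add_of_lt hij
    have h1 := hback i
    rw [h, show i + l + 1 = (i + 1) + l by ring, iterate_add_apply g, hg'] at h1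
    exact havoid l 0 h1.symm
  intro i j hij
  rcases lt_trichotomy i j with h | h | h
  · exact absurd hij (hlt i j h)
  · exact h
  · exact absurd hij.symm (hlt j i h)

/-- A repelling periodic point outside the postcritical set has homoclinic points. -/
theorem exists_homoclinic (f : RatFunc ℂ) (hd : 2 ≤ degree f) {z₀ : OnePoint ℂ}
    (hz₀ : IsRepellingPeriodic f z₀) (hpost : z₀ ∉ postcriticalSet f) {r : ℝ} (hr : 0 < r) :
    ∃ b ∈ Metric.ball (chart z₀ z₀) r, b ≠ chart z₀ z₀ ∧
      ∃ m, (toMap f)^[m] (chartInv z₀ b) = z₀ := by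
  by_contra! hno
  set F := toMap f with hFdef
  have hF : ∀ z, HolAt F z := holAt_toMap f (by omega)
  obtain ⟨⟨p', hp', hp'z⟩, hrep⟩ := hz₀
  have hper : z₀ ∈ periodicPts F := ⟨p', hp', hp'z⟩
  set p := period f z₀ with hpdef
  have hp : 0 < p := minimalPeriod_pos_of_mem_periodicPts hper
  have hfix : F^[p] z₀ = z₀ := isPeriodicPt_minimalPeriod F z₀
  have hy : F (F^[p - 1] z₀) = z₀ := by
    rw [← iterate_succ_apply' F, Nat.succ_eq_add_one, Nat.sub_add_cancel hp, hfix]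
  -- The preimage of `z₀` in its cycle is noncritical, so `z₀` has a second preimage, from which an
  -- infinite backward orbit starts.
  have hcrit : chartDeriv F (F^[p - 1] z₀) ≠ 0 := by
    intro h
    exact hpost (Set.mem_iUnion₂.2 ⟨1, le_rfl, _, h, hy⟩)
  obtain ⟨x₀, hx₀, hx₀F⟩ := exists_ne_toMap_eq f hd hcrit
  obtain ⟨x, hinj, hback, havoid⟩ := exists_backward_orbit (toMap_surjective f (by omega)) hper
    (hx₀F.trans hy) hx₀
  obtain ⟨N, hN⟩ : ∃ N, ∀ n, N ≤ n → x n ≠ ∞ := by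
    by_cases h : ∃ j, x j = ∞
    · obtain ⟨j, hj⟩ := h
      exact ⟨j + 1, fun n hn hx => by have := hinj (hx.trans hj.symm); omega⟩
    · exact ⟨0, fun n _ hx => h ⟨n, hx⟩⟩
  -- Reaching `x i` means later reaching `z₀`. This is excluded off the centre by assumption, and at
  -- the centre because the backward orbit avoids the cycle.
  have homit : ∀ n i, ∀ t ∈ Metric.ball (chart z₀ z₀) r, F^[n] (chartInv z₀ t) ≠ x i := by
    intro n i t ht h
    by_cases hta : t = chart z₀ z₀
    · rw [hta, chartInv_chart_self] at h
      exact havoid i n h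
    · refine hno t ht hta (i + 1 + n) ?_
      rw [iterate_add_apply, h, hback]
  obtain ⟨c₁, hc₁⟩ := OnePoint.ne_infty_iff_exists.1 (hN N le_rfl)
  obtain ⟨c₂, hc₂⟩ := OnePoint.ne_infty_iff_exists.1 (hN (N + 1) (by omega))
  obtain ⟨c₃, hc₃⟩ := OnePoint.ne_infty_iff_exists.1 (hN (N + 2) (by omega))
  have h21 : c₂ ≠ c₁ := by
    rintro rfl; have := hinj (hc₁.symm.trans hc₂); omega
  have h31 : c₃ ≠ c₁ := by
    rintro rfl; have := hinj (hc₁.symm.trans hc₃); omega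
  have h32 : c₂ ≠ c₃ := by
    rintro rfl; have := hinj (hc₂.symm.trans hc₃); omega
  have hαβ : (c₂ - c₁)⁻¹ ≠ (c₃ - c₁)⁻¹ := by
    intro h; exact h32 (by linear_combination inv_injective h)
  -- Of three omitted finite points, `c₁` is sent to infinity and the other two give the two omitted
  -- values. All iterates of `F^p` fix `z₀`, so a single `C` serves for every `n`.
  obtain ⟨C, hC⟩ := exists_norm_deriv_mul_le_of_omit (simplePole c₁ z₀) hαβ
  have hz₀c : chartInv z₀ (chart z₀ z₀) ≠ (c₁ : OnePoint ℂ) := by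
    rw [chartInv_chart_self, hc₁]; exact havoid N 0
  obtain ⟨k, hk0, hk⟩ := exists_hasDerivAt_simplePole hz₀c
  set lam := multiplier f z₀ with hlam
  have hbound : ∀ n, ‖k * lam ^ n‖ * r ≤ C := by
    intro n
    have hGz : (F^[p])^[n] z₀ = z₀ := iterate_fixed hfix n
    have hG : ∀ z, HolAt (F^[p])^[n] z := HolAt.iterate (HolAt.iterate hF p) n
    have hder : deriv (coord z₀ z₀ (F^[p])^[n]) (chart z₀ z₀) = lam ^ n := by
      have h1 := chartDeriv_iterate_of_fixed (HolAt.iterate hF p) hfix n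
      rw [chartDeriv_eq, hGz] at h1
      exact h1
    have h1 := HolAt.hasDerivAt_simplePole (c := c₁) (k := k) (v := z₀) (hG z₀) (ne_antipode z₀)
      (by rw [hGz]; exact ne_antipode z₀) (by rw [hGz]; exact hk)
    rw [hder] at h1
    rw [← h1.deriv]
    have hmul : (F^[p])^[n] = F^[p * n] := (iterate_mul F p n).symm
    refine hC _ _ r hr (fun t ht => ?_) (fun t ht h => ?_) (fun t ht h => ?_) ?_
    · have hne : (F^[p])^[n] (chartInv z₀ t) ≠ c₁ := by
        rw [hmul, hc₁]; exact homit _ _ t ht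
      rw [← chartInv_chart_self ((F^[p])^[n] (chartInv z₀ t))] at hne
      obtain ⟨k', -, hk'⟩ := exists_hasDerivAt_simplePole hne
      have := (hG (chartInv z₀ t)).hasDerivAt_simplePole (chartInv_ne_antipode z₀ t)
        (ne_antipode _) hk'
      rw [chart_chartInv] at this
      exact this.differentiableAt.differentiableWithinAt
    · refine homit (p * n) (N + 1) t ht ?_
      rw [← hc₂, ← hmul]
      exact simplePole_injOn h21 h
    · refine homit (p * n) (N + 2) t ht ?_
      rw [← hc₃, ← hmul]
      exact simplePole_injOn h31 h
    · simp only [chartInv_chart_self, hGz]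
  have hkr : 0 < ‖k‖ * r := mul_pos (norm_pos_iff.2 hk0) hr
  obtain ⟨n, hn⟩ := pow_unbounded_of_one_lt (C / (‖k‖ * r)) hrep
  have h1 := hbound n
  rw [norm_mul, norm_pow] at h1
  rw [div_lt_iff₀ hkr] at hn
  linarith

/-! ### Inverse branches, distortion and exponents -/

theorem exists_localInverse {G : OnePoint ℂ → OnePoint ℂ} {u : OnePoint ℂ} {b : ℂ}
    (hG : HolAt G (chartInv u b)) (hb : G (chartInv u b) = u)
    (hd : deriv (coord u u G) b ≠ 0) :
    ∃ H : ℂ → ℂ, H (chart u u) = b ∧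
      HasStrictDerivAt H (deriv (coord u u G) b)⁻¹ (chart u u) ∧
      ∀ᶠ s in 𝓝 (chart u u), G (chartInv u (H s)) = chartInv u s := by
  have hu := chartInv_ne_antipode u b
  have han := hG.2 u u hu (by rw [hb]; exact ne_antipode u)
  rw [chart_chartInv] at han
  have hs := han.hasStrictDerivAt
  have hval : coord u u G b = chart u u := by rw [coord, hb]
  have h1 := hs.to_localInverse hd
  have h2 : HasStrictDerivAt.localInverse _ _ _ hs hd (coord u u G b) = b :=
    HasStrictFDerivAt.localInverse_apply_image (hs.hasStrictFDerivAt_equiv hd)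
  have h3 : ∀ᶠ s in 𝓝 (coord u u G b),
      coord u u G (HasStrictDerivAt.localInverse _ _ _ hs hd s) = s :=
    HasStrictFDerivAt.eventually_right_inverse (hs.hasStrictFDerivAt_equiv hd)
  have h4 : ContinuousAt (fun s => G (chartInv u (HasStrictDerivAt.localInverse _ _ _ hs hd s)))
      (coord u u G b) := by
    refine ContinuousAt.comp (f := fun s =>
      chartInv u (HasStrictDerivAt.localInverse _ _ _ hs hd s)) ?_
      ((continuous_chartInv u).continuousAt.comp h1.hasDerivAt.continuousAt)
    rw [h2]; exact hG.1
  -- The inverse function theorem gives equality of coordinates only; avoiding `antipode u` upgrades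
  -- it to equality of points of the sphere.
  have h5 := h4.eventually_ne (y := antipode u) (by
    rw [h2, hb]; exact ne_antipode u)
  rw [hval] at h1 h2 h3 h5
  refine ⟨_, h2, h1, ?_⟩
  filter_upwards [h3, h5] with s hs1 hs2
  rw [← chartInv_chart hs2]
  exact congrArg (chartInv u) hs1

/-- Continuity of `log |G'|` at a noncritical point; this is all the distortion control that the
estimate of exponents needs. -/
theorem HolAt.eventually_abs_log_sub_le {G : OnePoint ℂ → OnePoint ℂ} {u : OnePoint ℂ} {b : ℂ}
    (hG : HolAt G (chartInv u b)) (hb : G (chartInv u b) = u)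
    (hd : deriv (coord u u G) b ≠ 0) {ε : ℝ} (hε : 0 < ε) :
    ∀ᶠ t in 𝓝 b, deriv (coord u u G) t ≠ 0 ∧
      |Real.log ‖deriv (coord u u G) t‖ - Real.log ‖deriv (coord u u G) b‖| ≤ ε := by
  have han := hG.2 u u (chartInv_ne_antipode u b) (by rw [hb]; exact ne_antipode u)
  rw [chart_chartInv] at han
  have hc : ContinuousAt (deriv (coord u u G)) b := han.deriv.continuousAt
  have hl : ContinuousAt (fun t => Real.log ‖deriv (coord u u G) t‖) b :=
    hc.norm.log (norm_ne_zero_iff.2 hd)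
  filter_upwards [hc.eventually_ne hd, Metric.continuousAt_iff'.1 hl ε hε] with t h1 h2
  exact ⟨h1, by rw [← Real.dist_eq]; exact h2.le⟩

/-- Iteration of a contracting inverse branch `g` of `F` in the coordinate `chart u`. -/
theorem iterate_inverse_branch {F : OnePoint ℂ → OnePoint ℂ} (hF : ∀ z, HolAt F z)
    {u : OnePoint ℂ} {a : ℂ} {g : ℂ → ℂ} {q : NNReal} {r ε L : ℝ} (hq : q ≤ 1) (hga : g a = a)
    (hlip : LipschitzOnWith q g (Metric.closedBall a r))
    (hinv : ∀ s ∈ Metric.closedBall a r, F (chartInv u (g s)) = chartInv u s)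
    (hdist : ∀ s ∈ Metric.closedBall a r, deriv (coord u u F) s ≠ 0 ∧
      |Real.log ‖deriv (coord u u F) s‖ - L| ≤ ε) (n : ℕ) :
    (∀ s ∈ Metric.closedBall a r, g^[n] s ∈ Metric.closedBall a r ∧
      F^[n] (chartInv u (g^[n] s)) = chartInv u s ∧
      deriv (coord u u F^[n]) (g^[n] s) ≠ 0 ∧
      |Real.log ‖deriv (coord u u F^[n]) (g^[n] s)‖ - n * L| ≤ n * ε) ∧
    ∀ s ∈ Metric.closedBall a r, ∀ t ∈ Metric.closedBall a r,
      dist (g^[n] s) (g^[n] t) ≤ q ^ n * dist s t := by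
  have hmaps : ∀ s ∈ Metric.closedBall a r, g s ∈ Metric.closedBall a r := by
    intro s hs
    have ha : a ∈ Metric.closedBall a r :=
      Metric.mem_closedBall_self (dist_nonneg.trans (Metric.mem_closedBall.1 hs))
    have h1 := hlip.dist_le_mul s hs a ha
    rw [hga] at h1
    rw [Metric.mem_closedBall] at hs ⊢
    have hq' : (q : ℝ) ≤ 1 := by exact_mod_cast hq
    nlinarith [dist_nonneg (x := s) (y := a)]
  induction n with
  | zero =>
    refine ⟨fun s hs => ⟨hs, rfl, ?_⟩, fun s _ t _ => by simp⟩
    rw [iterate_zero, coord_id_self, deriv_id]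
    simp
  | succ n ih =>
    refine ⟨fun s hs => ?_, fun s hs t ht => ?_⟩
    · obtain ⟨h1, h2, h3, h4⟩ := ih.1 s hs
      have h5 := hmaps _ h1
      have h6 := hinv _ h1
      obtain ⟨h7, h8⟩ := hdist _ h5
      have h9 : F^[n + 1] (chartInv u (g (g^[n] s))) = chartInv u s := by
        rw [iterate_succ_apply, h6, h2]
      have hder := (HolAt.iterate hF n (F (chartInv u (g (g^[n] s))))).deriv_coord_comp
        (u := u) (v := u) (w := u) (hF (chartInv u (g (g^[n] s)))) (chartInv_ne_antipode u _)
        (by rw [h6]; exact chartInv_ne_antipode u _)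
        (by rw [h6, h2]; exact chartInv_ne_antipode u _)
      rw [← iterate_succ, h6, chart_chartInv, chart_chartInv] at hder
      rw [iterate_succ_apply' g]
      refine ⟨h5, h9, ?_, ?_⟩
      · rw [hder]; exact mul_ne_zero h3 h7
      · rw [hder, norm_mul, Real.log_mul (norm_ne_zero_iff.2 h3) (norm_ne_zero_iff.2 h7)]
        push_cast
        rw [abs_le] at h4 h8 ⊢
        constructor <;> linarith [h4.1, h4.2, h8.1, h8.2]
    · rw [iterate_succ_apply' g, iterate_succ_apply' g, pow_succ', mul_assoc]
      exact (hlip.dist_le_mul _ (ih.1 s hs).1 _ (ih.1 t ht).1).trans (by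
        gcongr; exact ih.2 s hs t ht)

/-- Replacing the period by a multiple scales the logarithm of the multiplier by the same factor.
The exact period of the constructed point thus need not be known. -/
theorem charExponent_eq_of_iterate (f : RatFunc ℂ) (hd : 1 ≤ degree f) {w : OnePoint ℂ} {M : ℕ}
    (hM : 0 < M) (hw : (toMap f)^[M] w = w) (hne : chartDeriv (toMap f)^[M] w ≠ 0) :
    charExponent f w =
      ((1 / (M : ℝ) * Real.log ‖chartDeriv (toMap f)^[M] w‖ : ℝ) : EReal) := by
  obtain ⟨k, hk⟩ := IsPeriodicPt.minimalPeriod_dvd (f := toMap f) (n := M) (x := w) hw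
  have hfix : (toMap f)^[period f w] w = w := isPeriodicPt_minimalPeriod _ _
  have hpow : chartDeriv (toMap f)^[M] w = multiplier f w ^ k := by
    rw [hk, iterate_mul]
    exact chartDeriv_iterate_of_fixed (HolAt.iterate (holAt_toMap f hd) _) hfix k
  have hk0 : k ≠ 0 := by rintro rfl; omega
  have hmul : multiplier f w ≠ 0 := by
    intro h; rw [hpow, h, zero_pow hk0] at hne; exact hne rfl
  rw [charExponent, if_neg hmul, hpow, norm_pow, Real.log_pow]
  congr 1
  have hk0' : (k : ℝ) ≠ 0 := by exact_mod_cast hk0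
  have hM' : (M : ℝ) = period f w * k := by rw [hk]; push_cast; rfl
  have hp0 : (period f w : ℝ) ≠ 0 := by
    intro h; rw [h, zero_mul] at hM'; exact hM.ne' (by exact_mod_cast hM')
  rw [hM']
  field_simp

theorem exists_isFixedPt_of_dist_le {T : ℂ → ℂ} {a : ℂ} {s : ℝ} (hs : 0 ≤ s)
    (hmaps : Set.MapsTo T (Metric.closedBall a s) (Metric.closedBall a s))
    (hlip : ∀ x ∈ Metric.closedBall a s, ∀ y ∈ Metric.closedBall a s,
      dist (T x) (T y) ≤ 1 / 2 * dist x y) :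
    ∃ w ∈ Metric.closedBall a s, T w = w := by
  have hL : LipschitzOnWith (1 / 2) T (Metric.closedBall a s) :=
    LipschitzOnWith.of_dist_le_mul fun x hx y hy => by simpa using hlip x hx y hy
  have hC : ContractingWith (1 / 2) (hmaps.restrict T _ _) :=
    ⟨by rw [div_lt_one] <;> norm_num, hL.mapsToRestrict hmaps⟩
  obtain ⟨w, hw, hfix, -⟩ := hC.exists_fixedPoint' Metric.isClosed_closedBall.isComplete hmaps
    (Metric.mem_closedBall_self hs) (edist_ne_top _ _)
  exact ⟨w, hw, hfix⟩

/-- Repelling fixed points are isolated among the fixed points of every iterate. -/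
theorem eventually_iterate_ne {F : OnePoint ℂ → OnePoint ℂ} (hF : ∀ z, HolAt F z)
    {u : OnePoint ℂ} (hu : F u = u) (hrep : 1 < ‖chartDeriv F u‖) {n : ℕ} (hn : n ≠ 0) :
    ∀ᶠ t in 𝓝[≠] (chart u u), F^[n] (chartInv u t) ≠ chartInv u t := by
  have hfix : F^[n] u = u := iterate_fixed hu n
  have h1 := chartDeriv_iterate_of_fixed hF hu n
  rw [chartDeriv_eq, hfix] at h1
  have h2 := ((HolAt.iterate hF n u).2 u u (ne_antipode u)
    (by rw [hfix]; exact ne_antipode u)).differentiableAt.hasDerivAt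
  rw [h1] at h2
  -- In the chart, `F^n - id` has derivative `λ^n - 1` at the fixed point, which is nonzero since
  -- `|λ| > 1`; its zero there is therefore isolated.
  have h3 := h2.sub (hasDerivAt_id _)
  have h4 : chartDeriv F u ^ n - 1 ≠ 0 := by
    intro h
    have := congrArg norm (sub_eq_zero.1 h)
    rw [norm_pow, norm_one] at this
    exact (one_lt_pow₀ hrep hn).ne' this
  filter_upwards [h3.eventually_ne (c := 0) h4] with t ht h
  apply ht
  simp [coord, h]

/-! ### Periodic points shadowing the homoclinic orbit -/

theorem exists_periodic_near (f : RatFunc ℂ) (hd : 2 ≤ degree f) {z₀ : OnePoint ℂ}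
    (hz₀ : IsRepellingPeriodic f z₀) (hpost : z₀ ∉ postcriticalSet f) {ε : ℝ} (hε : 0 < ε)
    (N : ℕ) :
    ∃ w, IsPeriodic f w ∧ N < period f w ∧ ∃ χ : ℝ, charExponent f w = χ ∧
      |χ - 1 / (period f z₀ : ℝ) * Real.log ‖multiplier f z₀‖| ≤ 2 * ε := by
  set F := toMap f with hFdef
  have hF : ∀ z, HolAt F z := holAt_toMap f (by omega)
  obtain ⟨⟨p', hp', hp'z⟩, hrep⟩ := id hz₀
  set p := period f z₀ with hpdef
  have hp : 0 < p := minimalPeriod_pos_of_mem_periodicPts ⟨p', hp', hp'z⟩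
  have hfix : F^[p] z₀ = z₀ := isPeriodicPt_minimalPeriod F z₀
  set lam := multiplier f z₀ with hlam
  set L := Real.log ‖lam‖ with hL
  have hL0 : 0 < L := Real.log_pos hrep
  have hFp : ∀ z, HolAt F^[p] z := HolAt.iterate hF p
  set a := chart z₀ z₀ with ha
  have hκa : chartInv z₀ a = z₀ := chartInv_chart_self z₀
  have hfix' : F^[p] (chartInv z₀ a) = z₀ := by rw [hκa, hfix]
  have hder : deriv (coord z₀ z₀ F^[p]) a = lam := by
    have h1 : chartDeriv F^[p] z₀ = lam := rfl
    rwa [chartDeriv_eq, hfix] at h1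
  have hlam0 : lam ≠ 0 := norm_pos_iff.1 (zero_lt_one.trans hrep)
  -- the contracting inverse branch at the periodic point
  obtain ⟨g, hga, hg, hginv⟩ := exists_localInverse (hFp _) hfix' (by rwa [hder])
  rw [hder] at hg
  have hdistort := (hFp (chartInv z₀ a)).eventually_abs_log_sub_le hfix' (by rwa [hder]) hε
  rw [hder, ← hL] at hdistort
  obtain ⟨q, hq1, hq2⟩ : ∃ q : NNReal, ‖lam⁻¹‖₊ < q ∧ q < 1 := exists_between (by
    rw [nnnorm_inv]; exact inv_lt_one_of_one_lt₀ (by exact_mod_cast hrep))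
  obtain ⟨S, hS, hlipS⟩ := hg.hasStrictFDerivAt.exists_lipschitzOnWith_of_nnnorm_lt q (by
    rw [← NNReal.coe_lt_coe] at hq1 ⊢; simpa using hq1)
  obtain ⟨r, hr, hball⟩ := Metric.nhds_basis_closedBall.eventually_iff.1
    (hginv.and (hdistort.and hS))
  have hbranch := iterate_inverse_branch (u := z₀) hFp hq2.le hga
    (hlipS.mono fun x hx => (hball hx).2.2) (fun x hx => (hball hx).1)
    (fun x hx => (hball hx).2.1)
  -- the homoclinic point and the inverse branch along it
  obtain ⟨b, hbr, hba, m, hm⟩ := exists_homoclinic f hd hz₀ hpost hr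
  have hFm : ∀ z, HolAt F^[m] z := HolAt.iterate hF m
  -- A critical point at time `j < m` of the excursion would put `z₀` in the postcritical set, at
  -- time `m - j ≥ 1`.
  have hcrit : chartDeriv F^[m] (chartInv z₀ b) ≠ 0 := by
    refine chartDeriv_iterate_ne_zero hF fun j hj h => hpost ?_
    refine Set.mem_iUnion₂.2 ⟨m - j, by omega, _, h, ?_⟩
    rw [← iterate_add_apply, Nat.sub_add_cancel hj.le, hm]
  have hmd : deriv (coord z₀ z₀ F^[m]) b ≠ 0 := by
    have := (hFm _).deriv_coord_ne_zero (v := z₀) (chartInv_ne_antipode z₀ b)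
      (by rw [hm]; exact ne_antipode z₀) hcrit
    rwa [chart_chartInv] at this
  obtain ⟨h, hha, hh, hhinv⟩ := exists_localInverse (hFm _) hm hmd
  obtain ⟨K, S', hS', hlipS'⟩ := hh.hasStrictFDerivAt.exists_lipschitzOnWith
  have hhc : ContinuousAt h a := hh.hasDerivAt.continuousAt
  have hhr : ∀ᶠ s in 𝓝 a, h s ∈ Metric.closedBall a r :=
    hhc.eventually_mem (by
      rw [hha]
      exact mem_of_superset (Metric.isOpen_ball.mem_nhds hbr) Metric.ball_subset_closedBall)
  have hhd := hhc.tendsto.eventually (by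
    rw [hha]; exact (hFm _).eventually_abs_log_sub_le hm hmd zero_lt_one)
  obtain ⟨s, hs, hball'⟩ := Metric.nhds_basis_closedBall.eventually_iff.1
    (hhinv.and (hhr.and (hhd.and hS')))
  -- isolation of the periodic point
  have hiso := eventually_iterate_ne hFp hfix hrep (Nat.factorial_ne_zero N)
  rw [eventually_nhdsWithin_iff] at hiso
  obtain ⟨ρ, hρ, hiso⟩ := Metric.eventually_nhds_iff_ball.1 hiso
  -- the choice of the number of turns
  set B := |Real.log ‖deriv (coord z₀ z₀ F^[m]) b‖| + 1 with hB
  have hB0 : 0 ≤ B := by positivity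
  have hq0 : Tendsto (fun n : ℕ => (q : ℝ) ^ n) atTop (𝓝 0) :=
    tendsto_pow_atTop_nhds_zero_of_lt_one q.2 (by exact_mod_cast hq2)
  have hqr : Tendsto (fun n : ℕ => (q : ℝ) ^ n * r) atTop (𝓝 0) := by
    simpa using hq0.mul_const r
  have hqK : Tendsto (fun n : ℕ => (q : ℝ) ^ n * K) atTop (𝓝 0) := by
    simpa using hq0.mul_const (K : ℝ)
  have hCn : ∀ᶠ n : ℕ in atTop, (p * B + m * L) / ε ≤ n :=
    tendsto_natCast_atTop_atTop.eventually_ge_atTop _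
  obtain ⟨n, hn1, hn2, hn3, hn4, hn5⟩ := ((hqr.eventually_le_const hs).and
    ((hqr.eventually_lt_const hρ).and ((hqK.eventually_le_const one_half_pos).and
      (hCn.and (eventually_ge_atTop 1))))).exists
  have haball : a ∈ Metric.closedBall a r := Metric.mem_closedBall_self hr.le
  have hga' : g^[n] a = a := iterate_fixed hga n
  have hnear : ∀ x ∈ Metric.closedBall a r, dist (g^[n] x) a ≤ q ^ n * r := by
    intro x hx
    have h1 := (hbranch n).2 x hx a haball
    rw [hga'] at h1
    exact h1.trans (by gcongr; exact hx)
  obtain ⟨w, hw, hwfix⟩ := exists_isFixedPt_of_dist_le (T := fun x => g^[n] (h x)) hs.le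
    (fun x hx => (hnear _ (hball' hx).2.1).trans hn1) (fun x hx y hy => by
      refine ((hbranch n).2 _ (hball' hx).2.1 _ (hball' hy).2.1).trans ?_
      have h1 := hlipS'.dist_le_mul x (hball' hx).2.2.2 y (hball' hy).2.2.2
      calc (q : ℝ) ^ n * dist (h x) (h y) ≤ q ^ n * (K * dist x y) := by gcongr
        _ = q ^ n * K * dist x y := by ring
        _ ≤ 1 / 2 * dist x y := by gcongr)
  obtain ⟨hw1, hw2, ⟨hw3, hw3'⟩, -⟩ := hball' hw
  obtain ⟨-, hb1, hb2, hb3⟩ := (hbranch n).1 (h w) hw2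
  change g^[n] (h w) = w at hwfix
  rw [hwfix] at hb1 hb2 hb3
  rw [← iterate_mul] at hb1 hb2 hb3
  -- The orbit of `w` passes through `h w` at time `p n`. If `w = a`, this point would be both `z₀`
  -- and the homoclinic point `b`.
  have hwa : w ≠ a := by
    rintro hwa
    rw [hwa, hκa, hha] at hb1
    rw [iterate_mul, iterate_fixed hfix] at hb1
    apply hba
    rw [← chart_chartInv z₀ b, ← hb1]
  have hM : 0 < m + p * n := by positivity
  have hwper : F^[m + p * n] (chartInv z₀ w) = chartInv z₀ w := by
    rw [iterate_add_apply, hb1, hw1]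
  have hwne := chartInv_ne_antipode z₀ w
  have hDeriv : chartDeriv F^[m + p * n] (chartInv z₀ w) =
      deriv (coord z₀ z₀ F^[m]) (h w) * deriv (coord z₀ z₀ F^[p * n]) w := by
    rw [(HolAt.iterate hF _ _).chartDeriv_eq_of_fixed hwper hwne, iterate_add,
      HolAt.deriv_coord_comp (v := z₀) (hFm _) (HolAt.iterate hF _ _) hwne
        (by rw [hb1]; exact chartInv_ne_antipode _ _)
        (by rw [hb1, hw1]; exact chartInv_ne_antipode _ _),
      hb1, chart_chartInv, chart_chartInv]
  have hDne : chartDeriv F^[m + p * n] (chartInv z₀ w) ≠ 0 := by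
    rw [hDeriv]; exact mul_ne_zero hw3 hb2
  refine ⟨chartInv z₀ w, ⟨m + p * n, hM, hwper⟩, ?_, _,
    charExponent_eq_of_iterate f (by omega) hM hwper hDne, ?_⟩
  · by_contra! hle
    have hpos : 0 < period f (chartInv z₀ w) :=
      minimalPeriod_pos_of_mem_periodicPts ⟨m + p * n, hM, hwper⟩
    have hdvd : period f (chartInv z₀ w) ∣ p * N.factorial :=
      (Nat.dvd_factorial hpos hle).mul_left p
    have h1 : F^[p * N.factorial] (chartInv z₀ w) = chartInv z₀ w :=
      (isPeriodicPt_minimalPeriod F _).trans_dvd hdvd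
    rw [iterate_mul] at h1
    refine hiso w ?_ hwa h1
    rw [Metric.mem_ball, ← hwfix]
    exact (hnear _ hw2).trans_lt hn2
  · rw [hDeriv, norm_mul, Real.log_mul (norm_ne_zero_iff.2 hw3) (norm_ne_zero_iff.2 hb2)]
    set X := Real.log ‖deriv (coord z₀ z₀ F^[m]) (h w)‖
    set Y := Real.log ‖deriv (coord z₀ z₀ F^[p * n]) w‖
    have hX : |X| ≤ B := by
      have := abs_sub_abs_le_abs_sub X (Real.log ‖deriv (coord z₀ z₀ F^[m]) b‖)
      linarith
    have hp1 : (1 : ℝ) ≤ p := by exact_mod_cast hp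
    have hn1 : (1 : ℝ) ≤ n := by exact_mod_cast hn5
    have hm0 : (0 : ℝ) ≤ m := Nat.cast_nonneg m
    have hMr : (0 : ℝ) < m + p * n := by positivity
    rw [div_le_iff₀ hε] at hn4
    push_cast
    -- The error splits into the distortion near the cycle, `Y - n L`, bounded by `n ε`, and the
    -- contribution of the excursion, bounded independently of `n`. Each adds at most `ε` after
    -- division.
    have e1 : 1 / ((m : ℝ) + p * n) * (X + Y) - 1 / p * L =
        (p * (Y - n * L) + (p * X - m * L)) / (p * (m + p * n)) := by
      field_simp
      ring
    rw [e1, abs_div, abs_of_pos (by positivity : 0 < (p : ℝ) * (m + p * n)),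
      div_le_iff₀ (by positivity)]
    have e2 : |(p : ℝ) * (Y - n * L) + (p * X - m * L)| ≤ p * (n * ε) + (p * B + m * L) := by
      rw [abs_le] at hX hb3 ⊢
      have := mul_le_mul_of_nonneg_left hb3.1 (by positivity : (0 : ℝ) ≤ p)
      have := mul_le_mul_of_nonneg_left hb3.2 (by positivity : (0 : ℝ) ≤ p)
      have := mul_le_mul_of_nonneg_left hX.1 (by positivity : (0 : ℝ) ≤ p)
      have := mul_le_mul_of_nonneg_left hX.2 (by positivity : (0 : ℝ) ≤ p)
      have := mul_nonneg hm0 hL0.le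
      constructor <;> linarith
    refine e2.trans ?_
    have e3 : (n : ℝ) * ε ≤ p * (n * ε) := le_mul_of_one_le_left (by positivity) hp1
    have e4 : (p : ℝ) * (n * ε) ≤ p * (p * (n * ε)) := le_mul_of_one_le_left (by positivity) hp1
    have e5 : 0 ≤ 2 * ε * (p * m) := by positivity
    linarith

end RiemannSphere

/-! ### Extraction of the sequence -/

theorem lemma2p4 (f : RatFunc ℂ) (hd : 2 ≤ RiemannSphere.degree f)
    (z₀ : OnePoint ℂ) (hz₀ : RiemannSphere.IsRepellingPeriodic f z₀)
    (hpost : z₀ ∉ RiemannSphere.postcriticalSet f) :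
    ∃ w : ℕ → OnePoint ℂ,
      (∀ n, RiemannSphere.IsPeriodic f (w n)) ∧
      (∀ m n, m ≠ n → RiemannSphere.period f (w m) ≠ RiemannSphere.period f (w n)) ∧
      Tendsto (fun n => RiemannSphere.charExponent f (w n)) atTop
        (𝓝 (RiemannSphere.charExponent f z₀)) := by
  have key : ∀ N : ℕ, _ := fun N => RiemannSphere.exists_periodic_near f hd hz₀ hpost
    (Nat.one_div_pos_of_nat (α := ℝ) (n := N)) N
  choose v hv hvN χ hχ hlim using key
  have hper : Tendsto (fun n => RiemannSphere.period f (v n)) atTop atTop :=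
    tendsto_atTop_mono (fun n => (hvN n).le) tendsto_id
  -- Periods tending to infinity have a strictly increasing subsequence, hence pairwise distinct
  -- terms.
  obtain ⟨φ, hφ, hφper⟩ := strictMono_subseq_of_tendsto_atTop hper
  refine ⟨v ∘ φ, fun n => hv _, fun m n hmn => hφper.injective.ne hmn, ?_⟩
  have hne : RiemannSphere.multiplier f z₀ ≠ 0 :=
    norm_pos_iff.1 (zero_lt_one.trans hz₀.2)
  rw [RiemannSphere.charExponent, if_neg hne]
  refine Tendsto.comp (g := fun n => RiemannSphere.charExponent f (v n)) ?_ hφ.tendsto_atTop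
  simp only [hχ]
  refine (continuous_coe_real_ereal.tendsto _).comp ?_
  rw [tendsto_iff_dist_tendsto_zero]
  refine squeeze_zero (fun _ => dist_nonneg) (fun n => hlim n) ?_
  simpa using (tendsto_one_div_add_atTop_nhds_zero_nat (𝕜 := ℝ)).const_mul 2
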